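/- Let $X$ and $U$ be complex separable Hilbert spaces, $\tau>0$ and $\kappa\in\mathbb R$. Assume: ($A_1$) $A:D(A)\subset X\to X$ generates an immediately compact $C_0$-semigroup $S(\cdot)$ on $X$ (that is, $S(t)$ is compact for every $t>0$). ($A_2$) $B\in\mathcal L(U;X_{-1})$, where $X_{-1}$ is the completion of $X$ in the norm $\|f\|_{-1}=\|(\rho_0I-A)^{-1}f\|_X$ for a fixed $\rho_0\in\rho(A)\cap\mathbb R$. Its adjoint $B^*:D(A^*)\to U$ is given by $\langle Bu,\psi\rangle_{X_{-1},D(A^*)}=\langle u,B^*\psi\rangle_U$ for all $u\in U$ and $\psi\in D(A^*)$, where $\langle\cdot,\psi\rangle_{X_{-1},D(A^*)}$ is the continuous extension of $\langle\cdot,\psi\rangle_X$ to $X_{-1}$. ($A_3$) There are $T_0>0$ and $C_0>0$ such that $\int_0^{T_0}\|B^*S^*(t)\varphi\|_U^2\,dt\le C_0\|\varphi\|_X^2$ for all $\varphi\in D(A^*)$. Let $\mathcal X=X\times L^2(-\tau,0;X)$ with its product Hilbert space structure. For $t\ge0$ let $\mathcal S(t)(y_0,\varphi)^\top=(y(t),y(t+\cdot))^\top$,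 where $y$ is the mild solution of $y'(t)=Ay(t)+\kappa y(t-\tau)$ for $t>0$, $y(0)=y_0$, $y=\varphi$ on $(-\tau,0)$; that is, $y(t)=S(t)y_0+\kappa\int_0^tS(t-s)y(s-\tau)\,ds$ for $t\ge 0$. Let $\mathcal S^*(t)=(\mathcal S(t))^*$. Let $\mathcal A(f_1,f_2)^\top=(Af_1+\kappa f_2(-\tau),\partial_\theta f_2)^\top$ with domain $$D(\mathcal A)=\{(f_1,f_2)^\top\in\mathcal X: f_1\in D(A),\ f_2\in H^1(-\tau,0;X),\ f_2(0)=f_1\},$$ and let $\mathcal A^*$ be its adjoint. Fix $\rho_1\in\rho(\mathcal A)\cap\mathbb R$, let $\mathcal X_{-1}$ be the completion of $\mathcal X$ in the norm $\|(\rho_1I-\mathcal A)^{-1}f\|_{\mathcal X}$, and let $\mathcal B=(B,0)^\top\in\mathcal L(U;\mathcal X_{-1})$ be the composition of $B$ with the continuous extension $X_{-1}\to\mathcal X_{-1}$ of the map $x\mapsto(x,0)^\top$ from $X$ to $\mathcal X$. Let $\mathcal B^*:D(\mathcal A^*)\to U$ be the adjoint of $\mathcal B$, defined as $B^*$ was.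 Then $\mathcal B$ is an admissible control operator for $\mathcal S(\cdot)$: for every $T>0$ there is a constant $C(T)>0$ such that, for all $\varphi\in D(\mathcal A^*)$, one has $\mathcal S^*(t)\varphi\in D(\mathcal A^*)$ for all $t\ge0$, the function $t\mapsto\|\mathcal B^*\mathcal S^*(t)\varphi\|_U^2$ is integrable on $(0,T)$, and $$\int_0^T\|\mathcal B^*\mathcal S^*(t)\varphi\|_U^2\,dt\le C(T)\,\|\varphi\|_{\mathcal X}^2 .$$ -/

import Mathlib

open Set Filter Topology MeasureTheory
open scoped InnerProductSpace LinearPMap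

set_option linter.unusedSectionVars false

noncomputable section

/-! ## Strongly continuous semigroups and their generators -/

/-- A `C₀`-semigroup on a Banach space `H`. Only the operators `S t` with `0 ≤ t` matter; the values
at negative times are arbitrary and never used. -/
structure C0Semigroup (H : Type*) [NormedAddCommGroup H] [NormedSpace ℂ H] where
  op : ℝ → H →L[ℂ] H
  op_zero : op 0 = 1
  op_add : ∀ s t : ℝ, 0 ≤ s → 0 ≤ t → op (s + t) = op s * op t
  strongCont : ∀ x : H, ContinuousOn (fun t => op t x) (Ici 0)

namespace C0Semigroup

variable {H : Type*} [NormedAddCommGroup H] [NormedSpace ℂ H]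

/-- The graph of the infinitesimal generator: all pairs `(x, y)` with
`(S(h)x - x)/h → y` as `h → 0+`. -/
def generatorGraph (S : C0Semigroup H) : Submodule ℂ (H × H) where
  carrier := {p | Tendsto (fun h : ℝ => ((h⁻¹ : ℝ) : ℂ) • (S.op h p.1 - p.1)) (𝓝[>] 0) (𝓝 p.2)}
  add_mem' := by
    intro p q hp hq
    have := Tendsto.add hp hq
    refine this.congr fun h => ?_
    simp only [Prod.fst_add, map_add, ← smul_add]
    congr 1
    abel
  zero_mem' := by simp
  smul_mem' := by
    intro c p hp
    have := Tendsto.const_smul hp c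
    refine this.congr fun h => ?_
    simp only [Prod.smul_fst, map_smul, ← smul_sub]
    rw [smul_comm]

/-- The graph above is single valued. -/
theorem generatorGraph_single (S : C0Semigroup H) (p : H × H) (hp : p ∈ S.generatorGraph)
    (h0 : p.1 = 0) : p.2 = 0 := by
  have h1 : Tendsto (fun h : ℝ => ((h⁻¹ : ℝ) : ℂ) • (S.op h p.1 - p.1)) (𝓝[>] 0) (𝓝 p.2) := hp
  simp only [h0, map_zero, sub_zero, smul_zero] at h1
  exact (tendsto_nhds_unique h1 tendsto_const_nhds)

/-- The infinitesimal generator, as an unbounded operator: its domain consists of all `x` for which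
`lim_{h → 0+} (S(h)x - x)/h` exists, and its value at `x` is this limit. -/
def generator (S : C0Semigroup H) : H →ₗ.[ℂ] H := S.generatorGraph.toLinearPMap

/-- The semigroup is immediately compact: `S(t)` is a compact operator for every `t > 0`. -/
def ImmediatelyCompact (S : C0Semigroup H) : Prop :=
  ∀ t : ℝ, 0 < t → IsCompactOperator (S.op t)

end C0Semigroup

/-! ## Resolvents and extrapolation spaces -/

section Extrapolation

variable {H : Type*} [NormedAddCommGroup H] [InnerProductSpace ℂ H]

/-- The bounded operator `R` is the inverse of `z I - A : D(A) → H`. -/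
structure IsResolvent (A : H →ₗ.[ℂ] H) (z : ℂ) (R : H →L[ℂ] H) : Prop where
  mem : ∀ x, R x ∈ A.domain
  right : ∀ x, z • R x - A ⟨R x, mem x⟩ = x
  left : ∀ x : A.domain, R (z • (x : H) - A x) = x

/-- The resolvent set of an unbounded operator. -/
def opResolventSet (A : H →ₗ.[ℂ] H) : Set ℂ := {z | ∃ R : H →L[ℂ] H, IsResolvent A z R}

open Classical in
/-- `(z I - A)⁻¹` for `z` in the resolvent set (and `0` otherwise). -/
def opResolvent (A : H →ₗ.[ℂ] H) (z : ℂ) : H →L[ℂ] H :=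
  if h : ∃ R : H →L[ℂ] H, IsResolvent A z R then h.choose else 0

theorem opResolvent_spec {A : H →ₗ.[ℂ] H} {z : ℂ} (hz : z ∈ opResolventSet A) :
    IsResolvent A z (opResolvent A z) := by
  have h : ∃ R : H →L[ℂ] H, IsResolvent A z R := hz
  rw [opResolvent, dif_pos h]
  exact h.choose_spec

/-- A copy of `H`, to be normed by `‖f‖₋₁ = ‖(z I - A)⁻¹ f‖`. -/
@[nolint unusedArguments]
def PreExtrap (_A : H →ₗ.[ℂ] H) (_z : ℂ) : Type _ := H

instance (A : H →ₗ.[ℂ] H) (z : ℂ) : AddCommGroup (PreExtrap A z) :=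
  inferInstanceAs (AddCommGroup H)

instance (A : H →ₗ.[ℂ] H) (z : ℂ) : Module ℂ (PreExtrap A z) :=
  inferInstanceAs (Module ℂ H)

/-- The identity map, from `H` with the norm `‖·‖₋₁` to `H` with its own norm. -/
def PreExtrap.toH (A : H →ₗ.[ℂ] H) (z : ℂ) : PreExtrap A z →ₗ[ℂ] H where
  toFun f := f
  map_add' _ _ := rfl
  map_smul' _ _ := rfl

/-- The norm `‖f‖₋₁ = ‖(z I - A)⁻¹ f‖`. -/
instance (A : H →ₗ.[ℂ] H) (z : ℂ) : SeminormedAddCommGroup (PreExtrap A z) :=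
  SeminormedAddCommGroup.induced (PreExtrap A z) H
    ((opResolvent A z : H →ₗ[ℂ] H) ∘ₗ PreExtrap.toH A z)

instance (A : H →ₗ.[ℂ] H) (z : ℂ) : NormedSpace ℂ (PreExtrap A z) :=
  NormedSpace.induced ℂ (PreExtrap A z) H
    ((opResolvent A z : H →ₗ[ℂ] H) ∘ₗ PreExtrap.toH A z)

theorem PreExtrap.norm_def {A : H →ₗ.[ℂ] H} {z : ℂ} (f : PreExtrap A z) :
    ‖f‖ = ‖opResolvent A z (PreExtrap.toH A z f)‖ := rfl

/-- The extrapolation space `H₋₁`: the completion of `H` with respect to the norm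
`‖f‖₋₁ = ‖(z I - A)⁻¹ f‖`. -/
abbrev Extrap (A : H →ₗ.[ℂ] H) (z : ℂ) : Type _ := UniformSpace.Completion (PreExtrap A z)

/-- The canonical (dense) inclusion of `H` in `H₋₁`. -/
def Extrap.incl (A : H →ₗ.[ℂ] H) (z : ℂ) : PreExtrap A z →L[ℂ] Extrap A z :=
  UniformSpace.Completion.toComplL

variable [CompleteSpace H]

/-- For `ψ ∈ D(A*)` the functional `f ↦ ⟨f, ψ⟩` on `H` is bounded for the norm `‖·‖₋₁`. -/
theorem exists_pairing_bound {A : H →ₗ.[ℂ] H} {z : ℂ} (hz : z ∈ opResolventSet A)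
    (ψ : A†.domain) :
    ∃ C : ℝ, ∀ f : PreExtrap A z,
      ‖((innerSL ℂ (ψ : H) : H →ₗ[ℂ] ℂ) ∘ₗ PreExtrap.toH A z) f‖ ≤ C * ‖f‖ := by
  have hR := opResolvent_spec hz
  have hψ : Continuous ((innerₛₗ ℂ (ψ : H)).comp A.toFun) :=
    (LinearPMap.mem_adjoint_domain_iff A (ψ : H)).1 ψ.2
  let L : A.domain →L[ℂ] ℂ := ⟨(innerₛₗ ℂ (ψ : H)).comp A.toFun, hψ⟩
  refine ⟨‖z‖ * ‖(ψ : H)‖ + ‖L‖, fun f => ?_⟩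
  set g : H := PreExtrap.toH A z f with hg
  have e : inner ℂ (ψ : H) g = z * inner ℂ (ψ : H) (opResolvent A z g)
      - L ⟨opResolvent A z g, hR.mem g⟩ := by
    conv_lhs => rw [← hR.right g]
    rw [inner_sub_right, inner_smul_right]
    rfl
  change ‖inner ℂ (ψ : H) g‖ ≤ _
  rw [e, PreExtrap.norm_def, ← hg, add_mul]
  refine (norm_sub_le _ _).trans (add_le_add ?_ ?_)
  · rw [norm_mul, mul_assoc]
    gcongr
    exact norm_inner_le_norm _ _
  · exact L.le_opNorm _

/-- The duality pairing `⟨·, ψ⟩` between `H₋₁` and `ψ ∈ H₁* = D(A*)` with pivot space `H`: the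
continuous extension to `H₋₁` of the functional `f ↦ ⟨f, ψ⟩` on `H`. (Mathlib's inner product is
linear in its second argument.) -/
def extrapPairing {A : H →ₗ.[ℂ] H} {z : ℂ} (hz : z ∈ opResolventSet A) (ψ : A†.domain) :
    Extrap A z →L[ℂ] ℂ :=
  ContinuousLinearMap.extend
    (((innerSL ℂ (ψ : H) : H →ₗ[ℂ] ℂ) ∘ₗ PreExtrap.toH A z).mkContinuous
      (exists_pairing_bound hz ψ).choose (exists_pairing_bound hz ψ).choose_spec)
    (Extrap.incl A z)

theorem extrapPairing_incl {A : H →ₗ.[ℂ] H} {z : ℂ} (hz : z ∈ opResolventSet A) (ψ : A†.domain)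
    (f : PreExtrap A z) :
    extrapPairing hz ψ (Extrap.incl A z f) = inner ℂ (ψ : H) (PreExtrap.toH A z f) :=
  ContinuousLinearMap.extend_eq _ UniformSpace.Completion.denseRange_coe
    (UniformSpace.Completion.isUniformInducing_coe _) f

variable {U : Type*} [NormedAddCommGroup U] [InnerProductSpace ℂ U] [CompleteSpace U]

open Classical in
/-- The adjoint `B* : D(A*) → U` of a control operator `B ∈ L(U; H₋₁)`, that is
`⟨u, B*ψ⟩_U = ⟨B u, ψ⟩_{H₋₁, H₁*}` for all `u ∈ U` and `ψ ∈ D(A*)`. (It is given the value `0`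
outside `D(A*)`, so that it can be written for all vectors.) -/
def controlAdjoint {A : H →ₗ.[ℂ] H} {z : ℂ} (hz : z ∈ opResolventSet A) (B : U →L[ℂ] Extrap A z)
    (ψ : H) : U :=
  if hψ : ψ ∈ A†.domain then
    (InnerProductSpace.toDual ℂ U).symm ((extrapPairing hz ⟨ψ, hψ⟩).comp B)
  else 0

theorem inner_controlAdjoint {A : H →ₗ.[ℂ] H} {z : ℂ} (hz : z ∈ opResolventSet A)
    (B : U →L[ℂ] Extrap A z) (ψ : A†.domain) (u : U) :
    inner ℂ (controlAdjoint hz B (ψ : H)) u = extrapPairing hz ψ (B u) := by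
  rw [controlAdjoint, dif_pos ψ.2]
  simp

end Extrapolation

/-! ## The delay semigroup -/

section Delay

variable {X : Type*} [NormedAddCommGroup X] [InnerProductSpace ℂ X]

/-- Lebesgue measure on `(-τ, 0)`. -/
abbrev histMeasure (τ : ℝ) : Measure ℝ := volume.restrict (Ioo (-τ) 0)

/-- `L²(-τ, 0; X)`. -/
abbrev History (X : Type*) [NormedAddCommGroup X] (τ : ℝ) : Type _ := Lp X 2 (histMeasure τ)

/-- The Hilbert space `𝒳 = X × L²(-τ, 0; X)`. -/
abbrev DelayState (X : Type*) [NormedAddCommGroup X] (τ : ℝ) : Type _ :=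
  WithLp 2 (X × History X τ)

/-- `y` is a mild solution of `y'(t) = A y(t) + κ y(t-τ)` (`t > 0`), `y(0) = y₀`, `y = φ` on
`(-τ, 0)`, where `A` is the generator of `S`. -/
structure IsMildSolution (S : C0Semigroup X) (κ τ : ℝ) (y₀ : X) (φ : ℝ → X) (y : ℝ → X) :
    Prop where
  history : ∀ᵐ t ∂(histMeasure τ), y t = φ t
  duhamel : ∀ t : ℝ, 0 ≤ t →
    y t = S.op t y₀ + (κ : ℂ) • ∫ s in (0 : ℝ)..t, S.op (t - s) (y (s - τ))

/-- One step of the method of steps. -/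
def delayStep (S : C0Semigroup X) (κ τ : ℝ) (y₀ : X) (φ : ℝ → X) (y : ℝ → X) (t : ℝ) : X :=
  if t < 0 then φ t else S.op t y₀ + (κ : ℂ) • ∫ s in (0 : ℝ)..t, S.op (t - s) (y (s - τ))

theorem delayStep_iterate_congr (S : C0Semigroup X) (κ τ : ℝ) (y₀ : X) (φ : ℝ → X)
    (n : ℕ) (y z : ℝ → X) (t : ℝ) (ht : t < n * τ) :
    (delayStep S κ τ y₀ φ)^[n + 1] y t = (delayStep S κ τ y₀ φ)^[n + 1] z t := by
  induction n generalizing t with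
  | zero =>
    have : t < 0 := by simpa using ht
    simp [delayStep, this]
  | succ n ih =>
    rw [Function.iterate_succ_apply', Function.iterate_succ_apply' _ (n + 1) z]
    by_cases h : t < 0
    · simp [delayStep, h]
    · simp only [delayStep, h, if_false]
      congr 2
      refine intervalIntegral.integral_congr fun s hs => ?_
      rw [uIcc_of_le (not_lt.1 h)] at hs
      rw [ih (s - τ) (by push_cast at ht; linarith [hs.2])]

/-- The solution of the uncontrolled delay equation, constructed by the method of steps. -/
def delaySolution (S : C0Semigroup X) (κ τ : ℝ) (y₀ : X) (φ : ℝ → X) (t : ℝ) : X :=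
  (delayStep S κ τ y₀ φ)^[⌊t / τ⌋₊ + 2] 0 t

theorem delaySolution_eq_iterate (S : C0Semigroup X) (κ : ℝ) {τ : ℝ} (hτ : 0 < τ) (y₀ : X)
    (φ : ℝ → X) (n : ℕ) (z : ℝ → X) (t : ℝ) (ht : t < n * τ) :
    delaySolution S κ τ y₀ φ t = (delayStep S κ τ y₀ φ)^[n + 1] z t := by
  by_cases h : t < 0
  · rw [delaySolution, Function.iterate_succ_apply', Function.iterate_succ_apply' _ n z]
    simp [delayStep, h]
  · have hk : ⌊t / τ⌋₊ < n := by
      rw [Nat.floor_lt (div_nonneg (not_lt.1 h) hτ.le), div_lt_iff₀ hτ]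
      exact ht
    have ht' : t < ((⌊t / τ⌋₊ + 1 : ℕ) : ℝ) * τ := by
      rw [← div_lt_iff₀ hτ]
      push_cast
      exact Nat.lt_floor_add_one _
    obtain ⟨m, rfl⟩ := Nat.exists_eq_add_of_lt hk
    have e : ⌊t / τ⌋₊ + m + 1 + 1 = (⌊t / τ⌋₊ + 1 + 1) + m := by ring
    rw [e, Function.iterate_add_apply]
    exact delayStep_iterate_congr S κ τ y₀ φ _ _ _ t ht'

theorem delaySolution_eq_step (S : C0Semigroup X) (κ : ℝ) {τ : ℝ} (hτ : 0 < τ) (y₀ : X)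
    (φ : ℝ → X) (t : ℝ) :
    delaySolution S κ τ y₀ φ t = delayStep S κ τ y₀ φ (delaySolution S κ τ y₀ φ) t := by
  obtain ⟨n, hn⟩ : ∃ n : ℕ, t / τ < n := exists_nat_gt _
  rw [div_lt_iff₀ hτ] at hn
  have hn' : t < ((n + 1 : ℕ) : ℝ) * τ := by push_cast; linarith
  rw [delaySolution_eq_iterate S κ hτ y₀ φ (n + 1) 0 t hn', Function.iterate_succ_apply']
  by_cases h : t < 0
  · simp [delayStep, h]
  · simp only [delayStep, h, if_false]
    congr 2
    refine intervalIntegral.integral_congr fun s hs => ?_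
    rw [uIcc_of_le (not_lt.1 h)] at hs
    rw [delaySolution_eq_iterate S κ hτ y₀ φ n 0 (s - τ) (by linarith [hs.2])]

theorem delaySolution_of_neg (S : C0Semigroup X) (κ : ℝ) {τ : ℝ} (hτ : 0 < τ) (y₀ : X)
    (φ : ℝ → X) {t : ℝ} (ht : t < 0) : delaySolution S κ τ y₀ φ t = φ t := by
  rw [delaySolution_eq_step S κ hτ]
  simp [delayStep, ht]

/-- The constructed function is a mild solution. -/
theorem isMildSolution_delaySolution (S : C0Semigroup X) (κ : ℝ) {τ : ℝ} (hτ : 0 < τ) (y₀ : X)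
    (φ : ℝ → X) : IsMildSolution S κ τ y₀ φ (delaySolution S κ τ y₀ φ) where
  history := by
    filter_upwards [ae_restrict_mem measurableSet_Ioo] with t ht
    exact delaySolution_of_neg S κ hτ y₀ φ ht.2
  duhamel t ht := by
    conv_lhs => rw [delaySolution_eq_step S κ hτ]
    simp [delayStep, not_lt.2 ht]

/-- Mild solutions are unique. -/
theorem IsMildSolution.unique {S : C0Semigroup X} {κ τ : ℝ} (hτ : 0 < τ) {y₀ : X}
    {φ y z : ℝ → X} (hy : IsMildSolution S κ τ y₀ φ y) (hz : IsMildSolution S κ τ y₀ φ z)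
    (t : ℝ) (ht : 0 ≤ t) : y t = z t := by
  have hneg : ∀ᵐ r : ℝ, r ∈ Ioo (-τ) 0 → y r = z r := by
    have := hy.history.and hz.history
    rw [ae_restrict_iff' measurableSet_Ioo] at this
    filter_upwards [this] with r hr hm
    rw [(hr hm).1, (hr hm).2]
  have key : ∀ n : ℕ, ∀ t : ℝ, 0 ≤ t → t < n * τ → y t = z t := by
    intro n
    induction n with
    | zero => intro t h0 h1; simp at h1; linarith
    | succ n ih =>
      intro t h0 h1
      rw [hy.duhamel t h0, hz.duhamel t h0]
      congr 2
      refine intervalIntegral.integral_congr_ae ?_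
      have h2 : ∀ᵐ s : ℝ, s - τ ∈ Ioo (-τ) 0 → y (s - τ) = z (s - τ) :=
        (measurePreserving_sub_right volume τ).quasiMeasurePreserving.ae hneg
      have h3 : ∀ᵐ s : ℝ, s ≠ τ := by
        simp [ae_iff, measure_singleton]
      filter_upwards [h2, h3] with s hs hs3 hm
      rw [uIoc_of_le h0] at hm
      push_cast at h1
      by_cases hsτ : s < τ
      · rw [hs ⟨by linarith [hm.1], by linarith⟩]
      · rw [ih (s - τ) (by linarith) (by linarith [hm.2])]
  obtain ⟨n, hn⟩ : ∃ n : ℕ, t / τ < n := exists_nat_gt _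
  rw [div_lt_iff₀ hτ] at hn
  exact key n t ht hn

/-! Continuity and bounds for the solution. -/

variable [CompleteSpace X]

theorem C0Semigroup.exists_bound (S : C0Semigroup X) (T : ℝ) :
    ∃ M : ℝ, 0 ≤ M ∧ ∀ t ∈ Icc 0 T, ‖S.op t‖ ≤ M := by
  have : ∀ x : X, ∃ C, ∀ i : Icc (0 : ℝ) T, ‖S.op i x‖ ≤ C := by
    intro x
    have hc : ContinuousOn (fun t => S.op t x) (Icc 0 T) :=
      (S.strongCont x).mono Icc_subset_Ici_self
    obtain ⟨C, hC⟩ := isCompact_Icc.exists_bound_of_continuousOn hc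
    exact ⟨C, fun i => hC i i.2⟩
  obtain ⟨M, hM⟩ := banach_steinhaus this
  exact ⟨max M 0, le_max_right _ _, fun t ht => (hM ⟨t, ht⟩).trans (le_max_left _ _)⟩

theorem C0Semigroup.continuous_joint (S : C0Semigroup X) :
    Continuous (fun p : ℝ × X => S.op (max p.1 0) p.2) := by
  rw [continuous_iff_continuousAt]
  rintro ⟨t₀, x₀⟩
  obtain ⟨M, hM0, hM⟩ := S.exists_bound (max (t₀ + 1) 0)
  have hc : Continuous (fun t : ℝ => S.op (max t 0) x₀) :=
    (S.strongCont x₀).comp_continuous (by fun_prop) (fun t => mem_Ici.2 (le_max_right _ _))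
  have h1 : Tendsto (fun p : ℝ × X => M * ‖p.2 - x₀‖ +
      ‖S.op (max p.1 0) x₀ - S.op (max t₀ 0) x₀‖) (𝓝 (t₀, x₀)) (𝓝 0) := by
    have : Continuous (fun p : ℝ × X => M * ‖p.2 - x₀‖ +
      ‖S.op (max p.1 0) x₀ - S.op (max t₀ 0) x₀‖) := by
      have := hc.comp (continuous_fst (X := ℝ) (Y := X))
      simp only [Function.comp_def] at this
      fun_prop
    simpa using this.tendsto (t₀, x₀)
  rw [ContinuousAt, tendsto_iff_norm_sub_tendsto_zero]
  refine squeeze_zero' (Eventually.of_forall fun _ => norm_nonneg _) ?_ h1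
  have : ∀ᶠ p : ℝ × X in 𝓝 (t₀, x₀), p.1 < t₀ + 1 :=
    (continuous_fst.tendsto (t₀, x₀)).eventually (gt_mem_nhds (by simp))
  filter_upwards [this] with p hp
  have e : S.op (max p.1 0) p.2 - S.op (max t₀ 0) x₀ =
      S.op (max p.1 0) (p.2 - x₀) + (S.op (max p.1 0) x₀ - S.op (max t₀ 0) x₀) := by
    rw [map_sub]; abel
  rw [e]
  refine (norm_add_le _ _).trans (add_le_add ?_ le_rfl)
  exact (S.op _).le_of_opNorm_le (hM _ ⟨le_max_right _ _, max_le_max hp.le le_rfl⟩) _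

theorem C0Semigroup.aesm_conv (S : C0Semigroup X) (g : ℝ → X) (t : ℝ) {μ : Measure ℝ}
    (hg : AEStronglyMeasurable g μ) :
    AEStronglyMeasurable (fun s => S.op (max (t - s) 0) (g s)) μ :=
  S.continuous_joint.comp_aestronglyMeasurable
    (f := fun s => (t - s, g s))
    ((Continuous.aestronglyMeasurable (by fun_prop)).prodMk hg)

/-- Convolution of the semigroup with an integrable function is continuous. -/
theorem C0Semigroup.continuousOn_conv (S : C0Semigroup X) (g : ℝ → X) (T : ℝ)
    (hg : Integrable g) :
    ContinuousOn (fun t => ∫ s in (0 : ℝ)..t, S.op (t - s) (g s)) (Icc 0 T) := by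
  have hF : Continuous (fun t => ∫ s in (0 : ℝ)..t, S.op (max (t - s) 0) (g s)) := by
    rw [continuous_iff_continuousAt]
    intro t₀
    obtain ⟨M, hM0, hM⟩ := S.exists_bound (|t₀| + 1 + (|t₀| + 1))
    have := intervalIntegral.continuousAt_parametric_primitive_of_dominated (μ := volume)
      (F := fun t s => S.op (max (t - s) 0) (g s)) (fun s => M * ‖g s‖)
      (-(|t₀| + 1)) (|t₀| + 1) (a₀ := 0) (b₀ := t₀) (x₀ := t₀)
      (fun t => S.aesm_conv g t hg.aestronglyMeasurable.restrict) ?_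
      ((hg.norm.const_mul M).intervalIntegrable) ?_
      ⟨by linarith [abs_nonneg t₀], by linarith [abs_nonneg t₀]⟩
      ⟨by linarith [neg_abs_le t₀], by linarith [le_abs_self t₀]⟩ (by simp)
    · exact this.comp (f := fun t : ℝ => (t, t)) (by fun_prop)
    · have h1 : ∀ᶠ t in 𝓝 t₀, t < |t₀| + 1 := gt_mem_nhds (by linarith [le_abs_self t₀])
      filter_upwards [h1] with t ht
      rw [ae_restrict_iff' measurableSet_uIoc]
      refine Eventually.of_forall fun s hs => ?_
      rw [uIoc_of_le (by linarith [abs_nonneg t₀])] at hs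
      refine (S.op _).le_of_opNorm_le (hM _ ⟨le_max_right _ _, max_le ?_ ?_⟩) _
      · linarith [hs.1]
      · linarith [abs_nonneg t₀]
    · refine Eventually.of_forall fun s => ?_
      have : Continuous (fun t => S.op (max (t - s) 0) (g s)) :=
        S.continuous_joint.comp (f := fun t : ℝ => (t - s, g s)) (by fun_prop)
      exact this.continuousAt
  refine hF.continuousOn.congr fun t ht => ?_
  refine intervalIntegral.integral_congr fun s hs => ?_
  rw [uIcc_of_le ht.1] at hs
  rw [max_eq_left (by linarith [hs.2])]

theorem C0Semigroup.intervalIntegrable_conv (S : C0Semigroup X) (g : ℝ → X) {t : ℝ} (ht : 0 ≤ t)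
    (hg : IntegrableOn g (Ioc 0 t)) :
    IntervalIntegrable (fun s => S.op (t - s) (g s)) volume 0 t := by
  obtain ⟨M, hM0, hM⟩ := S.exists_bound t
  rw [intervalIntegrable_iff_integrableOn_Ioc_of_le ht]
  have h1 : IntegrableOn (fun s => S.op (max (t - s) 0) (g s)) (Ioc 0 t) := by
    refine Integrable.mono' (hg.norm.const_mul M) (S.aesm_conv g t hg.aestronglyMeasurable) ?_
    filter_upwards [ae_restrict_mem measurableSet_Ioc] with s hs
    exact (S.op _).le_of_opNorm_le
      (hM _ ⟨le_max_right _ _, max_le (by linarith [hs.1]) ht⟩) _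
  refine h1.congr_fun (fun s hs => ?_) measurableSet_Ioc
  simp only
  rw [max_eq_left (by linarith [hs.2])]

theorem integrableOn_shift {y : ℝ → X} {τ a b : ℝ} (h : IntegrableOn y (Ioc a b)) :
    IntegrableOn (fun s => y (s - τ)) (Ioc (a + τ) (b + τ)) ∧
      ∫ s in Ioc (a + τ) (b + τ), ‖y (s - τ)‖ = ∫ s in Ioc a b, ‖y s‖ := by
  have hp := (measurePreserving_sub_right volume τ).restrict_preimage
    (measurableSet_Ioc (a := a) (b := b))
  have e : (fun s : ℝ => s - τ) ⁻¹' Ioc a b = Ioc (a + τ) (b + τ) := by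
    simp
  rw [e] at hp
  have he : MeasurableEmbedding (fun s : ℝ => s - τ) :=
    (MeasurableEquiv.subRight τ).measurableEmbedding
  exact ⟨(hp.integrable_comp_emb he).2 h, hp.integral_comp he (fun s => ‖y s‖)⟩

/-- The solution with initial data `Y = (y₀, φ)`. -/
def stateSolution (S : C0Semigroup X) (κ τ : ℝ) (Y : DelayState X τ) : ℝ → X :=
  delaySolution S κ τ Y.fst (Y.snd : ℝ → X)

theorem DelayState.norm_fst_le {τ : ℝ} (Y : DelayState X τ) : ‖Y.fst‖ ≤ ‖Y‖ := by
  rw [WithLp.prod_norm_eq_of_L2]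
  exact Real.le_sqrt_of_sq_le (by nlinarith [sq_nonneg ‖Y.snd‖])

theorem DelayState.norm_snd_le {τ : ℝ} (Y : DelayState X τ) : ‖Y.snd‖ ≤ ‖Y‖ := by
  rw [WithLp.prod_norm_eq_of_L2]
  exact Real.le_sqrt_of_sq_le (by nlinarith [sq_nonneg ‖Y.fst‖])

theorem DelayState.norm_le_add {τ : ℝ} (Y : DelayState X τ) : ‖Y‖ ≤ ‖Y.fst‖ + ‖Y.snd‖ := by
  rw [WithLp.prod_norm_eq_of_L2, Real.sqrt_le_left (by positivity)]
  nlinarith [norm_nonneg Y.fst, norm_nonneg Y.snd]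

/-- If the solutions are bounded in `L²(-τ, T)` then they are continuous and bounded in
`[0, T + τ]`. -/
theorem stateSolution_sup_bound (S : C0Semigroup X) (κ : ℝ) {τ : ℝ} (hτ : 0 < τ) {T C : ℝ}
    (hC : 0 ≤ C)
    (h : ∀ Y : DelayState X τ,
      MemLp (stateSolution S κ τ Y) 2 (volume.restrict (Ioc (-τ) T)) ∧
      eLpNorm (stateSolution S κ τ Y) 2 (volume.restrict (Ioc (-τ) T)) ≤
        ENNReal.ofReal (C * ‖Y‖)) :
    ∃ D : ℝ, 0 ≤ D ∧ ∀ Y : DelayState X τ,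
      ContinuousOn (stateSolution S κ τ Y) (Icc 0 (T + τ)) ∧
      ∀ t ∈ Icc 0 (T + τ), ‖stateSolution S κ τ Y t‖ ≤ D * ‖Y‖ := by
  obtain ⟨M, hM0, hM⟩ := S.exists_bound (T + τ)
  set ν : Measure ℝ := volume.restrict (Ioc (-τ) T) with hν
  set K : ENNReal := ν univ ^ (1 / (1 : ENNReal).toReal - 1 / (2 : ENNReal).toReal) with hK
  have hKtop : K ≠ ⊤ := by
    refine ENNReal.rpow_ne_top_of_nonneg (by norm_num) (measure_ne_top _ _)
  refine ⟨M + |κ| * (M * (C * K.toReal)), by positivity, fun Y => ?_⟩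
  obtain ⟨hmem, hnorm⟩ := h Y
  set y := stateSolution S κ τ Y with hy
  have hint : IntegrableOn y (Ioc (-τ) T) := hmem.integrable (by norm_num)
  have hL1 : ∫ s in Ioc (-τ) T, ‖y s‖ ≤ C * ‖Y‖ * K.toReal := by
    rw [integral_norm_eq_lintegral_enorm hint.aestronglyMeasurable, ← eLpNorm_one_eq_lintegral_enorm]
    have h1 := (eLpNorm_le_eLpNorm_mul_rpow_measure_univ (p := 1) (q := 2) (by norm_num)
      hint.aestronglyMeasurable).trans (mul_le_mul_left hnorm K)
    have h2 := ENNReal.toReal_mono (ENNReal.mul_ne_top ENNReal.ofReal_ne_top hKtop) h1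
    rwa [ENNReal.toReal_mul, ENNReal.toReal_ofReal (by positivity)] at h2
  obtain ⟨hsh1, hsh2⟩ := integrableOn_shift (τ := τ) hint
  rw [neg_add_cancel] at hsh1 hsh2
  set g : ℝ → X := (Ioc 0 (T + τ)).indicator (fun s => y (s - τ)) with hg
  have hgi : Integrable g := hsh1.integrable_indicator measurableSet_Ioc
  have heq : ∀ t ∈ Icc 0 (T + τ), y t = S.op t Y.fst + (κ : ℂ) • ∫ s in (0 : ℝ)..t, S.op (t - s) (g s) := by
    intro t ht
    rw [hy, stateSolution, (isMildSolution_delaySolution S κ hτ Y.fst (Y.snd : ℝ → X)).duhamel t ht.1]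
    congr 2
    refine intervalIntegral.integral_congr_ae (Eventually.of_forall fun s hs => ?_)
    rw [uIoc_of_le ht.1] at hs
    rw [hg, indicator_of_mem (show s ∈ Ioc 0 (T + τ) from ⟨hs.1, hs.2.trans ht.2⟩)]
    rfl
  constructor
  · refine ContinuousOn.congr ?_ heq
    refine ContinuousOn.add ((S.strongCont _).mono Icc_subset_Ici_self) ?_
    exact (S.continuousOn_conv g (T + τ) hgi).const_smul _
  · intro t ht
    rw [heq t ht, add_mul]
    refine (norm_add_le _ _).trans (add_le_add ?_ ?_)
    · refine ((S.op t).le_of_opNorm_le (hM t ht) _).trans ?_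
      gcongr
      exact DelayState.norm_fst_le Y
    · rw [norm_smul, Complex.norm_real, Real.norm_eq_abs, mul_assoc, mul_assoc]
      gcongr
      have h3 : ‖∫ s in (0 : ℝ)..t, S.op (t - s) (g s)‖ ≤ ∫ s in (0 : ℝ)..t, M * ‖g s‖ := by
        refine intervalIntegral.norm_integral_le_of_norm_le ht.1
          (Eventually.of_forall fun s hs => ?_) (hgi.norm.const_mul M).intervalIntegrable
        exact (S.op _).le_of_opNorm_le (hM _ ⟨by linarith [hs.2], by linarith [hs.1, ht.2]⟩) _
      refine h3.trans ?_
      rw [intervalIntegral.integral_const_mul]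
      gcongr
      rw [intervalIntegral.integral_of_le ht.1]
      calc ∫ s in Ioc 0 t, ‖g s‖ ≤ ∫ s, ‖g s‖ :=
            setIntegral_le_integral hgi.norm (Eventually.of_forall fun _ => norm_nonneg _)
        _ = ∫ s in Ioc 0 (T + τ), ‖y (s - τ)‖ := by
            rw [← integral_indicator measurableSet_Ioc]
            congr 1
            ext s
            rw [hg, norm_indicator_eq_indicator_norm]
        _ ≤ C * K.toReal * ‖Y‖ := by
            rw [hsh2]
            linarith

/-- The solutions are bounded in `L²(-τ, nτ)`. -/
theorem stateSolution_memLp (S : C0Semigroup X) (κ : ℝ) {τ : ℝ} (hτ : 0 < τ) (n : ℕ) :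
    ∃ C : ℝ, 0 ≤ C ∧ ∀ Y : DelayState X τ,
      MemLp (stateSolution S κ τ Y) 2 (volume.restrict (Ioc (-τ) (n * τ))) ∧
      eLpNorm (stateSolution S κ τ Y) 2 (volume.restrict (Ioc (-τ) (n * τ))) ≤
        ENNReal.ofReal (C * ‖Y‖) := by
  have base : ∀ Y : DelayState X τ,
      MemLp (stateSolution S κ τ Y) 2 (volume.restrict (Ioc (-τ) 0)) ∧
      eLpNorm (stateSolution S κ τ Y) 2 (volume.restrict (Ioc (-τ) 0)) ≤
        ENNReal.ofReal (1 * ‖Y‖) := by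
    intro Y
    have e : volume.restrict (Ioc (-τ) 0) = histMeasure τ :=
      (Measure.restrict_congr_set Ioo_ae_eq_Ioc).symm
    have hae := (isMildSolution_delaySolution S κ hτ Y.fst (Y.snd : ℝ → X)).history
    rw [e]
    refine ⟨(Lp.memLp Y.snd).ae_eq (EventuallyEq.symm hae), ?_⟩
    rw [show eLpNorm (stateSolution S κ τ Y) 2 (histMeasure τ) =
      eLpNorm (Y.snd : ℝ → X) 2 (histMeasure τ) from eLpNorm_congr_ae hae, one_mul,
      ← ENNReal.ofReal_toReal (Lp.eLpNorm_ne_top Y.snd), ← Lp.norm_def]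
    exact ENNReal.ofReal_le_ofReal (DelayState.norm_snd_le Y)
  induction n with
  | zero =>
    refine ⟨1, zero_le_one, ?_⟩
    simpa using base
  | succ n ih =>
    obtain ⟨C, hC, h⟩ := ih
    obtain ⟨D, hD, hb⟩ := stateSolution_sup_bound S κ hτ hC h
    set T : ℝ := n * τ + τ with hT
    have hT0 : 0 ≤ T := by positivity
    set ν : Measure ℝ := volume.restrict (Ioc 0 T) with hν
    set K : ENNReal := ν univ ^ ((2 : ENNReal).toReal)⁻¹ with hK
    have hKtop : K ≠ ⊤ := ENNReal.rpow_ne_top_of_nonneg (by norm_num) (measure_ne_top _ _)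
    refine ⟨1 + K.toReal * D, by positivity, fun Y => ?_⟩
    obtain ⟨hb1, hb2⟩ := base Y
    obtain ⟨hc, hbd⟩ := hb Y
    set y := stateSolution S κ τ Y with hy
    have hae : ∀ᵐ t ∂ν, ‖y t‖ ≤ D * ‖Y‖ := by
      filter_upwards [ae_restrict_mem measurableSet_Ioc] with t ht
      exact hbd t ⟨ht.1.le, ht.2⟩
    have hm : AEStronglyMeasurable y ν :=
      (hc.mono Ioc_subset_Icc_self).aestronglyMeasurable measurableSet_Ioc
    have hmem : MemLp y 2 ν := MemLp.of_bound hm _ hae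
    have hle : eLpNorm y 2 ν ≤ ENNReal.ofReal (K.toReal * (D * ‖Y‖)) := by
      rw [ENNReal.ofReal_mul ENNReal.toReal_nonneg, ENNReal.ofReal_toReal hKtop]
      exact eLpNorm_le_of_ae_bound hae
    have hu : Ioc (-τ) T = Ioc (-τ) 0 ∪ Ioc 0 T :=
      (Ioc_union_Ioc_eq_Ioc (by linarith) hT0).symm
    have hdis : Disjoint (Ioc (-τ) 0) (Ioc 0 T) := by
      rw [Set.disjoint_left]
      intro x hx hx'
      linarith [hx.2, hx'.1]
    have hind : (Ioc (-τ) T).indicator y = (Ioc (-τ) 0).indicator y + (Ioc 0 T).indicator y := by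
      rw [hu, indicator_union_of_disjoint hdis]
      rfl
    have hTe : (((n + 1 : ℕ) : ℝ)) * τ = T := by rw [hT]; push_cast; ring
    rw [hTe, ← memLp_indicator_iff_restrict measurableSet_Ioc,
      ← eLpNorm_indicator_eq_eLpNorm_restrict measurableSet_Ioc, hind]
    have i1 : MemLp ((Ioc (-τ) 0).indicator y) 2 volume :=
      (memLp_indicator_iff_restrict measurableSet_Ioc).2 hb1
    have i2 : MemLp ((Ioc 0 T).indicator y) 2 volume :=
      (memLp_indicator_iff_restrict measurableSet_Ioc).2 hmem
    refine ⟨i1.add i2, ?_⟩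
    refine (eLpNorm_add_le i1.1 i2.1 (by norm_num)).trans ?_
    rw [eLpNorm_indicator_eq_eLpNorm_restrict measurableSet_Ioc,
      eLpNorm_indicator_eq_eLpNorm_restrict measurableSet_Ioc]
    refine (add_le_add hb2 hle).trans ?_
    rw [← ENNReal.ofReal_add (by positivity) (by positivity)]
    exact ENNReal.ofReal_le_ofReal (by linarith)

theorem stateSolution_integrableOn (S : C0Semigroup X) (κ : ℝ) {τ : ℝ} (hτ : 0 < τ)
    (Y : DelayState X τ) (T : ℝ) : IntegrableOn (stateSolution S κ τ Y) (Ioc (-τ) T) := by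
  obtain ⟨n, hn⟩ : ∃ n : ℕ, T / τ < n := exists_nat_gt _
  rw [div_lt_iff₀ hτ] at hn
  obtain ⟨C, -, h⟩ := stateSolution_memLp S κ hτ n
  have h1 : IntegrableOn (stateSolution S κ τ Y) (Ioc (-τ) (n * τ)) :=
    (h Y).1.integrable (by norm_num)
  exact h1.mono_set (Ioc_subset_Ioc_right hn.le)

theorem stateSolution_conv (S : C0Semigroup X) (κ : ℝ) {τ : ℝ} (hτ : 0 < τ)
    (Y : DelayState X τ) {t : ℝ} (ht : 0 ≤ t) :
    IntervalIntegrable (fun s => S.op (t - s) (stateSolution S κ τ Y (s - τ))) volume 0 t := by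
  refine S.intervalIntegrable_conv (fun s => stateSolution S κ τ Y (s - τ)) ht ?_
  have := (integrableOn_shift (τ := τ) (stateSolution_integrableOn S κ hτ Y (t - τ))).1
  simpa using this

theorem stateSolution_add (S : C0Semigroup X) (κ : ℝ) {τ : ℝ} (hτ : 0 < τ)
    (Y Z : DelayState X τ) :
    IsMildSolution S κ τ (Y + Z).fst ((Y + Z).snd : ℝ → X)
      (fun t => stateSolution S κ τ Y t + stateSolution S κ τ Z t) where
  history := by
    filter_upwards [(isMildSolution_delaySolution S κ hτ Y.fst (Y.snd : ℝ → X)).history,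
      (isMildSolution_delaySolution S κ hτ Z.fst (Z.snd : ℝ → X)).history,
      Lp.coeFn_add Y.snd Z.snd] with t h1 h2 h3
    rw [WithLp.add_snd, h3, stateSolution, stateSolution, h1, h2]
    rfl
  duhamel t ht := by
    simp only [map_add]
    rw [intervalIntegral.integral_add (stateSolution_conv S κ hτ Y ht)
      (stateSolution_conv S κ hτ Z ht)]
    have h1 := (isMildSolution_delaySolution S κ hτ Y.fst (Y.snd : ℝ → X)).duhamel t ht
    have h2 := (isMildSolution_delaySolution S κ hτ Z.fst (Z.snd : ℝ → X)).duhamel t ht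
    simp only [stateSolution, WithLp.add_fst, map_add, smul_add]
    rw [h1, h2]
    abel

theorem stateSolution_smul (S : C0Semigroup X) (κ : ℝ) {τ : ℝ} (hτ : 0 < τ)
    (c : ℂ) (Y : DelayState X τ) :
    IsMildSolution S κ τ (c • Y).fst ((c • Y).snd : ℝ → X)
      (fun t => c • stateSolution S κ τ Y t) where
  history := by
    filter_upwards [(isMildSolution_delaySolution S κ hτ Y.fst (Y.snd : ℝ → X)).history,
      Lp.coeFn_smul c Y.snd] with t h1 h3
    rw [WithLp.smul_snd, h3, stateSolution, h1]
    rfl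
  duhamel t ht := by
    simp only [map_smul]
    rw [intervalIntegral.integral_smul]
    have h1 := (isMildSolution_delaySolution S κ hτ Y.fst (Y.snd : ℝ → X)).duhamel t ht
    simp only [stateSolution, WithLp.smul_fst, map_smul]
    conv_lhs => rw [h1]
    rw [smul_add, smul_comm c]

theorem ae_shift_of_mild {S : C0Semigroup X} {κ τ : ℝ} (hτ : 0 < τ) {y₀ : X}
    {φ y z : ℝ → X} (hy : IsMildSolution S κ τ y₀ φ y) (hz : IsMildSolution S κ τ y₀ φ z)
    {t : ℝ} (ht : 0 ≤ t) : ∀ᵐ θ ∂(histMeasure τ), y (t + θ) = z (t + θ) := by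
  have hneg : ∀ᵐ r : ℝ, r ∈ Ioo (-τ) 0 → y r = z r := by
    have := hy.history.and hz.history
    rw [ae_restrict_iff' measurableSet_Ioo] at this
    filter_upwards [this] with r hr hm
    rw [(hr hm).1, (hr hm).2]
  have h2 : ∀ᵐ θ : ℝ, t + θ ∈ Ioo (-τ) 0 → y (t + θ) = z (t + θ) :=
    (measurePreserving_add_left volume t).quasiMeasurePreserving.ae hneg
  rw [ae_restrict_iff' measurableSet_Ioo]
  filter_upwards [h2] with θ h hθ
  by_cases h0 : 0 ≤ t + θ
  · exact hy.unique hτ hz _ h0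
  · exact h ⟨by linarith [hθ.1], not_le.1 h0⟩

theorem exists_state_bound (S : C0Semigroup X) (κ : ℝ) {τ : ℝ} (hτ : 0 < τ) {t : ℝ} (ht : 0 ≤ t) :
    ∃ C : ℝ, 0 ≤ C ∧ ∀ Y : DelayState X τ,
      MemLp (fun θ => stateSolution S κ τ Y (t + θ)) 2 (histMeasure τ) ∧
      eLpNorm (fun θ => stateSolution S κ τ Y (t + θ)) 2 (histMeasure τ) ≤
        ENNReal.ofReal (C * ‖Y‖) ∧
      ‖stateSolution S κ τ Y t‖ ≤ C * ‖Y‖ := by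
  obtain ⟨n, hn⟩ : ∃ n : ℕ, t / τ < n := exists_nat_gt _
  rw [div_lt_iff₀ hτ] at hn
  obtain ⟨C, hC, h⟩ := stateSolution_memLp S κ hτ n
  obtain ⟨D, hD, hb⟩ := stateSolution_sup_bound S κ hτ hC h
  have hp := (measurePreserving_add_left volume t).restrict_preimage
    (measurableSet_Ioo (a := t + -τ) (b := t + 0))
  have e : (fun s : ℝ => t + s) ⁻¹' Ioo (t + -τ) (t + 0) = Ioo (-τ) 0 := by
    ext s; simp
  rw [e] at hp
  have hle : volume.restrict (Ioo (t + -τ) (t + 0)) ≤ volume.restrict (Ioc (-τ) (n * τ)) :=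
    Measure.restrict_mono_set _ fun s hs => ⟨by linarith [hs.1], by linarith [hs.2]⟩
  refine ⟨max C D, le_max_of_le_left hC, fun Y => ⟨?_, ?_, ?_⟩⟩
  · exact ((h Y).1.mono_measure hle).comp_measurePreserving hp
  · have := eLpNorm_comp_measurePreserving (p := 2) ((h Y).1.mono_measure hle).1 hp
    refine (this.le.trans ((eLpNorm_mono_measure _ hle).trans (h Y).2)).trans ?_
    exact ENNReal.ofReal_le_ofReal (by gcongr; exact le_max_left _ _)
  · refine ((hb Y).2 t ⟨ht, by linarith⟩).trans ?_
    gcongr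
    exact le_max_right _ _

/-- The state at time `t`: `(y(t), y(t + ·))` for the solution `y` with initial data `Y`. -/
def delayStateAt (S : C0Semigroup X) (κ : ℝ) {τ : ℝ} (hτ : 0 < τ) {t : ℝ} (ht : 0 ≤ t)
    (Y : DelayState X τ) : DelayState X τ :=
  WithLp.toLp 2 (stateSolution S κ τ Y t,
    MemLp.toLp (fun θ => stateSolution S κ τ Y (t + θ))
      ((exists_state_bound S κ hτ ht).choose_spec.2 Y).1)

/-- The state at time `t` as a bounded linear function of the initial data. -/
def delayOp (S : C0Semigroup X) (κ : ℝ) {τ : ℝ} (hτ : 0 < τ) {t : ℝ} (ht : 0 ≤ t) :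
    DelayState X τ →L[ℂ] DelayState X τ :=
  LinearMap.mkContinuous
    { toFun := delayStateAt S κ hτ ht
      map_add' := by
        intro Y Z
        have h1 := isMildSolution_delaySolution S κ hτ (Y + Z).fst ((Y + Z).snd : ℝ → X)
        have h2 := stateSolution_add S κ hτ Y Z
        have e1 : (delayStateAt S κ hτ ht (Y + Z)).fst =
            (delayStateAt S κ hτ ht Y).fst + (delayStateAt S κ hτ ht Z).fst :=
          h1.unique hτ h2 t ht
        have e2 : (delayStateAt S κ hτ ht (Y + Z)).snd =
            (delayStateAt S κ hτ ht Y).snd + (delayStateAt S κ hτ ht Z).snd :=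
          MemLp.toLp_congr ((exists_state_bound S κ hτ ht).choose_spec.2 (Y + Z)).1
            (((exists_state_bound S κ hτ ht).choose_spec.2 Y).1.add
              ((exists_state_bound S κ hτ ht).choose_spec.2 Z).1)
            (ae_shift_of_mild hτ h1 h2 ht)
        exact (WithLp.ofLp_injective 2) (Prod.ext e1 e2)
      map_smul' := by
        intro c Y
        have h1 := isMildSolution_delaySolution S κ hτ (c • Y).fst ((c • Y).snd : ℝ → X)
        have h2 := stateSolution_smul S κ hτ c Y
        have e1 : (delayStateAt S κ hτ ht (c • Y)).fst = c • (delayStateAt S κ hτ ht Y).fst :=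
          h1.unique hτ h2 t ht
        have e2 : (delayStateAt S κ hτ ht (c • Y)).snd = c • (delayStateAt S κ hτ ht Y).snd :=
          MemLp.toLp_congr ((exists_state_bound S κ hτ ht).choose_spec.2 (c • Y)).1
            (((exists_state_bound S κ hτ ht).choose_spec.2 Y).1.const_smul c)
            (ae_shift_of_mild hτ h1 h2 ht)
        exact (WithLp.ofLp_injective 2) (Prod.ext e1 e2) }
    (2 * (exists_state_bound S κ hτ ht).choose) (by
      intro Y
      obtain ⟨-, h⟩ := (exists_state_bound S κ hτ ht).choose_spec
      have hC := (exists_state_bound S κ hτ ht).choose_spec.1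
      obtain ⟨hm, h1, h2⟩ := h Y
      refine (DelayState.norm_le_add _).trans ?_
      have h3 : ‖(delayStateAt S κ hτ ht Y).snd‖ ≤
          (exists_state_bound S κ hτ ht).choose * ‖Y‖ := by
        have : ‖(delayStateAt S κ hτ ht Y).snd‖ = ENNReal.toReal
            (eLpNorm (fun θ => stateSolution S κ τ Y (t + θ)) 2 (histMeasure τ)) :=
          Lp.norm_toLp _ hm
        rw [this]
        exact ENNReal.toReal_le_of_le_ofReal (by positivity) h1
      have h4 : ‖(delayStateAt S κ hτ ht Y).fst‖ ≤
          (exists_state_bound S κ hτ ht).choose * ‖Y‖ := h2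
      have := add_le_add h4 h3
      refine this.trans (le_of_eq (by ring)))

/-- The delay semigroup `𝒮(t)(y₀, φ) = (y(t), y(t + ·))`, `t ≥ 0`, where `y` is the mild solution of
`y'(t) = A y(t) + κ y(t-τ)` with `y(0) = y₀` and `y = φ` on `(-τ, 0)` (and, irrelevantly, `0` for
`t < 0`). -/
def delaySemigroup (S : C0Semigroup X) (κ : ℝ) {τ : ℝ} (hτ : 0 < τ) (t : ℝ) :
    DelayState X τ →L[ℂ] DelayState X τ :=
  if ht : 0 ≤ t then delayOp S κ hτ ht else 0

/-- The description of `𝒮(t)` by an arbitrary mild solution. -/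
theorem delaySemigroup_spec (S : C0Semigroup X) (κ : ℝ) {τ : ℝ} (hτ : 0 < τ) {t : ℝ} (ht : 0 ≤ t)
    (Y : DelayState X τ) (y : ℝ → X) (hy : IsMildSolution S κ τ Y.fst (Y.snd : ℝ → X) y) :
    (delaySemigroup S κ hτ t Y).fst = y t ∧
      ∀ᵐ θ ∂(histMeasure τ), ((delaySemigroup S κ hτ t Y).snd : ℝ → X) θ = y (t + θ) := by
  have h1 := isMildSolution_delaySolution S κ hτ Y.fst (Y.snd : ℝ → X)
  rw [delaySemigroup, dif_pos ht]
  refine ⟨h1.unique hτ hy t ht, ?_⟩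
  have h2 := MemLp.coeFn_toLp ((exists_state_bound S κ hτ ht).choose_spec.2 Y).1
  filter_upwards [h2, ae_shift_of_mild hτ h1 hy ht] with θ h3 h4
  exact h3.trans h4

/-! ## The generator of the delay semigroup and the lifted control operator -/

/-- `f ∈ H¹(-τ, 0; X)` with weak derivative `∂f = g ∈ L²(-τ, 0; X)` and `f(0) = v`. As usual
`f` is identified with its absolutely continuous representative `θ ↦ v + ∫₀^θ g`. -/
def IsH1 {τ : ℝ} (f g : History X τ) (v : X) : Prop :=
  ∀ᵐ θ ∂(histMeasure τ), (f : ℝ → X) θ = v + ∫ s in (0 : ℝ)..θ, (g : ℝ → X) s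

theorem History.integrableOn {τ : ℝ} (g : History X τ) : IntegrableOn (g : ℝ → X) (Ioc (-τ) 0) := by
  have h : Integrable (g : ℝ → X) (histMeasure τ) := (Lp.memLp g).integrable (by norm_num)
  rwa [IntegrableOn, ← Measure.restrict_congr_set Ioo_ae_eq_Ioc]

theorem History.intervalIntegrable {τ : ℝ} (g : History X τ) {θ : ℝ} (h : θ ∈ Icc (-τ) 0) :
    IntervalIntegrable (g : ℝ → X) volume 0 θ := by
  rw [intervalIntegrable_iff, uIoc_of_ge h.2]
  exact g.integrableOn.mono_set (Ioc_subset_Ioc_left h.1)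

theorem History.integral_congr {τ : ℝ} {g : History X τ} {k : ℝ → X}
    (hgk : ∀ᵐ s ∂(histMeasure τ), (g : ℝ → X) s = k s) {θ : ℝ} (h : θ ∈ Icc (-τ) 0) :
    ∫ s in (0 : ℝ)..θ, (g : ℝ → X) s = ∫ s in (0 : ℝ)..θ, k s := by
  refine intervalIntegral.integral_congr_ae ?_
  have e : histMeasure τ = volume.restrict (Ioc (-τ) 0) :=
    Measure.restrict_congr_set Ioo_ae_eq_Ioc
  replace hgk : ∀ᵐ s ∂(volume.restrict (Ioc (-τ) 0)), (g : ℝ → X) s = k s := e ▸ hgk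
  rw [ae_restrict_iff' measurableSet_Ioc] at hgk
  filter_upwards [hgk] with s hs hm
  rw [uIoc_of_ge h.2] at hm
  exact hs ⟨h.1.trans_lt hm.1, hm.2⟩

theorem History.integral_add {τ : ℝ} (g k : History X τ) {θ : ℝ} (h : θ ∈ Icc (-τ) 0) :
    ∫ s in (0 : ℝ)..θ, ((g + k : History X τ) : ℝ → X) s =
      (∫ s in (0 : ℝ)..θ, (g : ℝ → X) s) + ∫ s in (0 : ℝ)..θ, (k : ℝ → X) s := by
  rw [History.integral_congr (k := fun s => (g : ℝ → X) s + (k : ℝ → X) s) (Lp.coeFn_add g k) h,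
    intervalIntegral.integral_add (g.intervalIntegrable h) (k.intervalIntegrable h)]

theorem History.integral_smul {τ : ℝ} (c : ℂ) (g : History X τ) {θ : ℝ} (h : θ ∈ Icc (-τ) 0) :
    ∫ s in (0 : ℝ)..θ, ((c • g : History X τ) : ℝ → X) s =
      c • ∫ s in (0 : ℝ)..θ, (g : ℝ → X) s := by
  rw [History.integral_congr (k := fun s => c • (g : ℝ → X) s) (Lp.coeFn_smul c g) h,
    intervalIntegral.integral_smul]

theorem IsH1.add {τ : ℝ} {f g f' g' : History X τ} {v v' : X} (h : IsH1 f g v)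
    (h' : IsH1 f' g' v') : IsH1 (f + f') (g + g') (v + v') := by
  filter_upwards [h, h', Lp.coeFn_add f f', ae_restrict_mem measurableSet_Ioo] with θ h1 h2 h3 h4
  rw [h3, Pi.add_apply, h1, h2, History.integral_add g g' ⟨h4.1.le, h4.2.le⟩]
  abel

theorem IsH1.smul {τ : ℝ} {f g : History X τ} {v : X} (c : ℂ) (h : IsH1 f g v) :
    IsH1 (c • f) (c • g) (c • v) := by
  filter_upwards [h, Lp.coeFn_smul c f, ae_restrict_mem measurableSet_Ioo] with θ h1 h3 h4
  rw [h3, Pi.smul_apply, h1, History.integral_smul c g ⟨h4.1.le, h4.2.le⟩, smul_add]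

theorem isH1_zero {τ : ℝ} : IsH1 (0 : History X τ) 0 0 := by
  filter_upwards [Lp.coeFn_zero X 2 (histMeasure τ), ae_restrict_mem measurableSet_Ioo]
    with θ h1 h4
  rw [h1, History.integral_congr (k := fun _ => 0) (Lp.coeFn_zero X 2 (histMeasure τ))
    ⟨h4.1.le, h4.2.le⟩]
  simp

/-- The weak derivative is unique. -/
theorem IsH1.deriv_eq_zero {τ : ℝ} (hτ : 0 < τ) {g : History X τ} {v : X} (h : IsH1 0 g v) : g = 0 := by
  have h0 : ∀ᵐ θ ∂(histMeasure τ), v + ∫ s in (0 : ℝ)..θ, (g : ℝ → X) s = 0 := by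
    filter_upwards [h, Lp.coeFn_zero X 2 (histMeasure τ)] with θ h1 h2
    rw [← h1, h2]; rfl
  have hii : IntervalIntegrable (g : ℝ → X) volume (-τ) 0 :=
    (g.intervalIntegrable ⟨le_rfl, by linarith⟩).symm
  have hcont : ContinuousOn (fun θ => v + ∫ s in (0 : ℝ)..θ, (g : ℝ → X) s) (Ioo (-τ) 0) := by
    have := intervalIntegral.continuousOn_primitive_interval' hii
      (a := 0) (by rw [uIcc_of_le (by linarith)]; exact ⟨by linarith, le_rfl⟩)
    rw [uIcc_of_le (by linarith)] at this
    exact continuousOn_const.add (this.mono Ioo_subset_Icc_self)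
  have hall : EqOn (fun θ => v + ∫ s in (0 : ℝ)..θ, (g : ℝ → X) s) (fun _ => 0) (Ioo (-τ) 0) :=
    Measure.eqOn_open_of_ae_eq h0 isOpen_Ioo hcont continuousOn_const
  ext1
  have hd := hii.ae_hasDerivAt_integral
  rw [EventuallyEq, ae_restrict_iff' measurableSet_Ioo]
  have hz := Lp.coeFn_zero X 2 (histMeasure τ)
  rw [EventuallyEq, ae_restrict_iff' measurableSet_Ioo] at hz
  filter_upwards [hd, hz] with θ h1 h2 hθ
  rw [h2 hθ]
  have h3 := h1 (by rw [uIcc_of_le (by linarith)]; exact Ioo_subset_Icc_self hθ) 0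
    (by rw [uIcc_of_le (by linarith)]; exact ⟨by linarith, le_rfl⟩)
  have h4 : HasDerivAt (fun r => ∫ s in (0 : ℝ)..r, (g : ℝ → X) s) 0 θ := by
    refine (hasDerivAt_const θ (-v)).congr_of_eventuallyEq ?_
    filter_upwards [isOpen_Ioo.mem_nhds hθ] with r hr
    have := hall hr
    simp only at this
    exact (neg_eq_of_add_eq_zero_right this).symm
  exact h3.unique h4

/-- The graph of the operator `𝒜(f₁, f₂) = (A f₁ + κ f₂(-τ), ∂f₂)` with domain
`D(𝒜) = {(f₁, f₂) : f₁ ∈ D(A), f₂ ∈ H¹(-τ, 0; X), f₂(0) = f₁}`: it consists of all pairs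
`((f₁, f₂), (w, g))` such that `f₁ ∈ D(A)`, `f₂ ∈ H¹(-τ, 0; X)`, `∂f₂ = g`, `f₂(0) = f₁` and
`w = A f₁ + κ f₂(-τ)`, where `f₂(-τ) = f₁ + ∫₀^{-τ} g`. -/
def delayGraph (A : X →ₗ.[ℂ] X) (κ : ℝ) {τ : ℝ} (hτ : 0 < τ) :
    Submodule ℂ (DelayState X τ × DelayState X τ) where
  carrier := {p | IsH1 p.1.snd p.2.snd p.1.fst ∧ ∃ h : p.1.fst ∈ A.domain,
    p.2.fst = A ⟨p.1.fst, h⟩ +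
      (κ : ℂ) • (p.1.fst + ∫ s in (0 : ℝ)..(-τ), (p.2.snd : ℝ → X) s)}
  add_mem' := by
    rintro p q ⟨h1, h2, h3⟩ ⟨h1', h2', h3'⟩
    refine ⟨h1.add h1', A.domain.add_mem h2 h2', ?_⟩
    have e : A ⟨(p + q).1.fst, A.domain.add_mem h2 h2'⟩ =
        A ⟨p.1.fst, h2⟩ + A ⟨q.1.fst, h2'⟩ := by
      rw [← LinearPMap.map_add]; rfl
    rw [e]
    simp only [Prod.fst_add, Prod.snd_add, WithLp.add_fst, WithLp.add_snd]
    rw [h3, h3', History.integral_add _ _ ⟨le_rfl, by linarith⟩]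
    simp only [smul_add]
    abel
  zero_mem' := by
    refine ⟨isH1_zero, A.domain.zero_mem, ?_⟩
    have e : A ⟨(0 : DelayState X τ × DelayState X τ).1.fst, A.domain.zero_mem⟩ = 0 :=
      LinearPMap.map_zero A
    rw [e]
    simp only [Prod.fst_zero, Prod.snd_zero, WithLp.zero_fst, WithLp.zero_snd]
    rw [History.integral_congr (k := fun _ => 0) (Lp.coeFn_zero X 2 (histMeasure τ))
      ⟨le_rfl, by linarith⟩]
    simp
  smul_mem' := by
    rintro c p ⟨h1, h2, h3⟩
    refine ⟨h1.smul c, A.domain.smul_mem c h2, ?_⟩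
    have e : A ⟨(c • p).1.fst, A.domain.smul_mem c h2⟩ = c • A ⟨p.1.fst, h2⟩ := by
      rw [← LinearPMap.map_smul]; rfl
    rw [e]
    simp only [Prod.smul_fst, Prod.smul_snd, WithLp.smul_fst, WithLp.smul_snd]
    rw [h3, History.integral_smul _ _ ⟨le_rfl, by linarith⟩, smul_add, smul_comm c, smul_add]

theorem delayGraph_single (A : X →ₗ.[ℂ] X) (κ : ℝ) {τ : ℝ} (hτ : 0 < τ)
    (p : DelayState X τ × DelayState X τ) (hp : p ∈ delayGraph A κ hτ) (h0 : p.1 = 0) :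
    p.2 = 0 := by
  obtain ⟨h1, h2, h3⟩ := hp
  have hf : p.1.fst = 0 := by rw [h0]; rfl
  have hs : p.1.snd = 0 := by rw [h0]; rfl
  rw [hs] at h1
  have hg := h1.deriv_eq_zero hτ
  have e : A ⟨p.1.fst, h2⟩ = 0 := by
    have : (⟨p.1.fst, h2⟩ : A.domain) = 0 := Subtype.ext hf
    rw [this, LinearPMap.map_zero]
  refine (WithLp.ofLp_injective 2) (Prod.ext ?_ hg)
  change p.2.fst = 0
  rw [h3, e, hf, hg, History.integral_congr (k := fun _ => 0) (Lp.coeFn_zero X 2 (histMeasure τ))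
    ⟨le_rfl, by linarith⟩]
  simp

/-- The operator `𝒜(f₁, f₂) = (A f₁ + κ f₂(-τ), ∂f₂)` with domain
`D(𝒜) = {(f₁, f₂) ∈ 𝒳 : f₁ ∈ D(A), f₂ ∈ H¹(-τ, 0; X), f₂(0) = f₁}`. -/
def delayGenerator (A : X →ₗ.[ℂ] X) (κ : ℝ) {τ : ℝ} (hτ : 0 < τ) :
    DelayState X τ →ₗ.[ℂ] DelayState X τ :=
  (delayGraph A κ hτ).toLinearPMap

theorem delayGenerator_graph (A : X →ₗ.[ℂ] X) (κ : ℝ) {τ : ℝ} (hτ : 0 < τ) :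
    (delayGenerator A κ hτ).graph = delayGraph A κ hτ :=
  Submodule.toLinearPMap_graph_eq _ (delayGraph_single A κ hτ)

/-- The bounded operator `v ↦ (θ ↦ e^{ρθ} v)` from `X` to `L²(-τ, 0; X)`. -/
theorem exists_expHistory (τ ρ : ℝ) (v : X) :
    ∃ f : History X τ, (∀ᵐ θ ∂(histMeasure τ), (f : ℝ → X) θ = ((Real.exp (ρ * θ) : ℝ) : ℂ) • v) ∧
      ‖f‖ ≤ ((histMeasure τ univ) ^ ((2 : ENNReal).toReal)⁻¹).toReal *
        (Real.exp (|ρ| * |τ|) * ‖v‖) := by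
  have hb : ∀ᵐ θ ∂(histMeasure τ), ‖((Real.exp (ρ * θ) : ℝ) : ℂ) • v‖ ≤
      Real.exp (|ρ| * |τ|) * ‖v‖ := by
    filter_upwards [ae_restrict_mem measurableSet_Ioo] with θ hθ
    rw [norm_smul, Complex.norm_real, Real.norm_eq_abs, Real.abs_exp]
    have h1 : |ρ * θ| ≤ |ρ| * |τ| := by
      rw [abs_mul]
      refine mul_le_mul_of_nonneg_left ?_ (abs_nonneg _)
      rw [abs_of_neg hθ.2]
      exact (by linarith [hθ.1] : -θ ≤ τ).trans (le_abs_self τ)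
    exact mul_le_mul_of_nonneg_right (Real.exp_le_exp.2 ((le_abs_self _).trans h1))
      (norm_nonneg _)
  have hm : MemLp (fun θ : ℝ => ((Real.exp (ρ * θ) : ℝ) : ℂ) • v) 2 (histMeasure τ) :=
    MemLp.of_bound (Continuous.aestronglyMeasurable (by fun_prop)) _ hb
  refine ⟨hm.toLp _, hm.coeFn_toLp, ?_⟩
  rw [Lp.norm_toLp]
  have h1 := eLpNorm_le_of_ae_bound (p := 2) hb
  have h2 := ENNReal.toReal_mono (ENNReal.mul_ne_top
    (ENNReal.rpow_ne_top_of_nonneg (by norm_num) (measure_ne_top _ _)) ENNReal.ofReal_ne_top) h1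
  rwa [ENNReal.toReal_mul, ENNReal.toReal_ofReal (by positivity)] at h2

/-- The map `x ↦ (x, 0)` is bounded from `X` with the norm `‖(ρ₀ I - A)⁻¹ x‖` to `𝒳` with the norm
`‖(ρ₁ I - 𝒜)⁻¹ ·‖`. -/
theorem exists_lift_bound (A : X →ₗ.[ℂ] X) (κ : ℝ) {τ : ℝ} (hτ : 0 < τ) {ρ₀ ρ₁ : ℝ}
    (h₀ : (ρ₀ : ℂ) ∈ opResolventSet A) (h₁ : (ρ₁ : ℂ) ∈ opResolventSet (delayGenerator A κ hτ)) :
    ∃ C : ℝ, ∀ x : X,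
      ‖opResolvent (delayGenerator A κ hτ) ρ₁ (WithLp.toLp 2 (x, 0))‖ ≤
        C * ‖opResolvent A ρ₀ x‖ := by
  have R0 := opResolvent_spec h₀
  have R1 := opResolvent_spec h₁
  set 𝓡 := opResolvent (delayGenerator A κ hτ) ρ₁ with h𝓡
  set R := opResolvent A ρ₀ with hR
  set μ : ℂ := (ρ₁ : ℂ) - ρ₀ - κ * ((Real.exp (ρ₁ * (-τ)) : ℝ) : ℂ) with hμ
  set K : ℝ := ((histMeasure τ univ) ^ ((2 : ENNReal).toReal)⁻¹).toReal *
        Real.exp (|ρ₁| * |τ|) with hK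
  refine ⟨1 + K + ‖𝓡‖ * ‖μ‖, fun x => ?_⟩
  set v : X := R x with hv
  obtain ⟨f, hf, hfn⟩ := exists_expHistory τ ρ₁ v
  set Y : DelayState X τ := WithLp.toLp 2 (v, f) with hY
  have hprim : ∀ θ : ℝ, ∫ s in (0 : ℝ)..θ, (ρ₁ : ℂ) • (((Real.exp (ρ₁ * s) : ℝ) : ℂ) • v) =
      ((Real.exp (ρ₁ * θ) : ℝ) : ℂ) • v - v := by
    intro θ
    have hder : ∀ s ∈ uIcc 0 θ, HasDerivAt (fun s : ℝ => ((Real.exp (ρ₁ * s) : ℝ) : ℂ) • v)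
        ((ρ₁ : ℂ) • (((Real.exp (ρ₁ * s) : ℝ) : ℂ) • v)) s := by
      intro s _
      have h1 : HasDerivAt (fun s : ℝ => Real.exp (ρ₁ * s)) (Real.exp (ρ₁ * s) * (ρ₁ * 1)) s :=
        ((hasDerivAt_id s).const_mul ρ₁).exp
      have h2 := (h1.ofReal_comp).smul_const v
      refine h2.congr_deriv ?_
      rw [smul_smul]
      congr 1
      push_cast
      ring
    rw [intervalIntegral.integral_eq_sub_of_hasDerivAt hder
      (Continuous.intervalIntegrable (by fun_prop) _ _)]
    simp
  have hsm : ∀ᵐ s ∂(histMeasure τ), (((ρ₁ : ℂ) • f : History X τ) : ℝ → X) s =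
      (ρ₁ : ℂ) • (((Real.exp (ρ₁ * s) : ℝ) : ℂ) • v) := by
    filter_upwards [hf, Lp.coeFn_smul (ρ₁ : ℂ) f] with s h1 h2
    rw [h2, Pi.smul_apply, h1]
  have hH1 : IsH1 f ((ρ₁ : ℂ) • f) v := by
    filter_upwards [hf, ae_restrict_mem measurableSet_Ioo] with θ h1 h2
    rw [h1, History.integral_congr hsm ⟨h2.1.le, h2.2.le⟩, hprim]
    abel
  have hAv : A ⟨v, R0.mem x⟩ = (ρ₀ : ℂ) • v - x := by
    have h2 : (ρ₀ : ℂ) • v - A ⟨v, R0.mem x⟩ = x := R0.right x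
    exact (sub_eq_of_eq_add' (eq_add_of_sub_eq h2)).symm
  set W : DelayState X τ := WithLp.toLp 2
    ((ρ₀ : ℂ) • v - x + (κ : ℂ) • (((Real.exp (ρ₁ * (-τ)) : ℝ) : ℂ) • v), (ρ₁ : ℂ) • f) with hW
  have hmem : (Y, W) ∈ (delayGenerator A κ hτ).graph := by
    rw [delayGenerator_graph]
    refine ⟨hH1, R0.mem x, ?_⟩
    change _ = A ⟨v, R0.mem x⟩ + (κ : ℂ) • (v + ∫ s in (0 : ℝ)..(-τ),
      (((ρ₁ : ℂ) • f : History X τ) : ℝ → X) s)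
    rw [hAv, History.integral_congr hsm ⟨le_rfl, by linarith⟩, hprim]
    change (ρ₀ : ℂ) • v - x + (κ : ℂ) • (((Real.exp (ρ₁ * (-τ)) : ℝ) : ℂ) • v) = _
    congr 2
    abel
  obtain ⟨Y', hY', hW'⟩ := (LinearPMap.mem_graph_iff _).1 hmem
  have hleft := R1.left Y'
  rw [hY', hW'] at hleft
  have hdecomp : (WithLp.toLp 2 (x, 0) : DelayState X τ) =
      ((ρ₁ : ℂ) • Y - W) - μ • (WithLp.toLp 2 (v, 0) : DelayState X τ) := by
    refine (WithLp.ofLp_injective 2) (Prod.ext ?_ ?_)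
    · change x = ((ρ₁ : ℂ) • v - ((ρ₀ : ℂ) • v - x +
        (κ : ℂ) • (((Real.exp (ρ₁ * (-τ)) : ℝ) : ℂ) • v))) - μ • v
      rw [hμ, sub_smul, sub_smul, mul_smul]
      abel
    · change (0 : History X τ) = ((ρ₁ : ℂ) • f - (ρ₁ : ℂ) • f) - μ • (0 : History X τ)
      simp
  have hYn : ‖Y‖ ≤ (1 + K) * ‖v‖ := by
    refine (DelayState.norm_le_add Y).trans ?_
    change ‖v‖ + ‖f‖ ≤ _
    rw [add_mul, one_mul, hK, mul_assoc]
    gcongr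
  have hv0 : ‖(WithLp.toLp 2 (v, 0) : DelayState X τ)‖ ≤ ‖v‖ := by
    refine (DelayState.norm_le_add _).trans ?_
    change ‖v‖ + ‖(0 : History X τ)‖ ≤ ‖v‖
    simp
  rw [hdecomp, map_sub, hleft, map_smul, add_mul]
  refine (norm_sub_le _ _).trans (add_le_add hYn ?_)
  rw [norm_smul, mul_comm ‖𝓡‖, mul_assoc]
  gcongr
  exact (𝓡.le_opNorm _).trans (by gcongr)

/-- The map `x ↦ (x, 0)`, bounded for the norms `‖·‖₋₁` of `X` and of `𝒳`. -/
def preLift (A : X →ₗ.[ℂ] X) (κ : ℝ) {τ : ℝ} (hτ : 0 < τ) {ρ₀ ρ₁ : ℝ}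
    (h₀ : (ρ₀ : ℂ) ∈ opResolventSet A) (h₁ : (ρ₁ : ℂ) ∈ opResolventSet (delayGenerator A κ hτ)) :
    PreExtrap A (ρ₀ : ℂ) →L[ℂ] PreExtrap (delayGenerator A κ hτ) (ρ₁ : ℂ) :=
  LinearMap.mkContinuous
    { toFun := fun x => (WithLp.toLp 2 (PreExtrap.toH A ρ₀ x, 0) : DelayState X τ)
      map_add' := fun x y => by
        change (WithLp.toLp 2 (PreExtrap.toH A ρ₀ x + PreExtrap.toH A ρ₀ y, 0) : DelayState X τ) =
          (WithLp.toLp 2 (PreExtrap.toH A ρ₀ x, 0) : DelayState X τ) +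
          (WithLp.toLp 2 (PreExtrap.toH A ρ₀ y, 0) : DelayState X τ)
        rw [← WithLp.toLp_add, Prod.mk_add_mk, add_zero]
      map_smul' := fun c x => by
        change (WithLp.toLp 2 (c • PreExtrap.toH A ρ₀ x, 0) : DelayState X τ) =
          c • (WithLp.toLp 2 (PreExtrap.toH A ρ₀ x, 0) : DelayState X τ)
        rw [← WithLp.toLp_smul, Prod.smul_mk, smul_zero] }
    (exists_lift_bound A κ hτ h₀ h₁).choose
    (exists_lift_bound A κ hτ h₀ h₁).choose_spec

/-- The embedding `X₋₁ → 𝒳₋₁`, `x ↦ (x, 0)`: the continuous extension of `x ↦ (x, 0)`, `X → 𝒳`. -/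
def extrapLift (A : X →ₗ.[ℂ] X) (κ : ℝ) {τ : ℝ} (hτ : 0 < τ) {ρ₀ ρ₁ : ℝ}
    (h₀ : (ρ₀ : ℂ) ∈ opResolventSet A) (h₁ : (ρ₁ : ℂ) ∈ opResolventSet (delayGenerator A κ hτ)) :
    Extrap A (ρ₀ : ℂ) →L[ℂ] Extrap (delayGenerator A κ hτ) (ρ₁ : ℂ) :=
  (preLift A κ hτ h₀ h₁).completion

/-- The lifted control operator `ℬ = (B, 0)ᵀ ∈ L(U; 𝒳₋₁)` of `B ∈ L(U; X₋₁)`. -/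
def liftedControl (A : X →ₗ.[ℂ] X) (κ : ℝ) {τ : ℝ} (hτ : 0 < τ) {ρ₀ ρ₁ : ℝ}
    (h₀ : (ρ₀ : ℂ) ∈ opResolventSet A) (h₁ : (ρ₁ : ℂ) ∈ opResolventSet (delayGenerator A κ hτ))
    {U : Type*} [NormedAddCommGroup U] [InnerProductSpace ℂ U] (B : U →L[ℂ] Extrap A (ρ₀ : ℂ)) :
    U →L[ℂ] Extrap (delayGenerator A κ hτ) (ρ₁ : ℂ) :=
  (extrapLift A κ hτ h₀ h₁).comp B

end Delay

end

/-! Let `R` be the resolvent of `A` at `ρ₀`. The domain of `A*` is the range of `R*`, and on it `B*`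
becomes bounded: `B* R* = K`, where `K` is the adjoint of the extended resolvent composed with `B`
(`controlAdjoint_adjoint_opResolvent`). Since `S*(t)` commutes with `R*`, admissibility of `B` is
the estimate `∫ ‖K S*(t) η‖² ≤ C ‖R* η‖²` for all `η`, which involves bounded operators only.

If `φ = (φ₁, φ₂)` lies in `D(𝒜*)`, then `φ₁` lies in `D(A*)` and `ℬ* φ = B* φ₁`
(`fst_mem_adjoint_domain`, `controlAdjoint_liftedControl`). Up to time `τ` the delay does not act on
states `(x, 0)`, so by duality the first component of `𝒮*(t) φ` is `p(t) = S*(t) φ₁ + ∫₀ᵗ S*(t-s)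
φ₂(-s) ds` (`fst_adjoint_delaySemigroup`). The obstacle is that `B*` cannot be moved under the
integral, because `φ₂(-s)` need not lie in `D(A*)`. Still `p(t)` itself does lie there, because
`𝒮*(t)` preserves `D(𝒜*)` (`adjoint_delaySemigroup_mem_domain`); write `p(t) = R* η(t)`, so that the
observation is `K η(t)`.

The remedy is to regularise. With `V_h` the average of `S*` over `[0, h]`, the operator `L_h = (ρ₀ -
A*) V_h` is bounded, commutes with `S*`, and satisfies `L_h R* = V_h`. Hence `K L_h` is a bounded
observation with `∫ ‖K L_h S*(t) ψ‖² ≤ C ‖V_h ψ‖² ≤ C M² ‖ψ‖²`, uniformly in `h`. For bounded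
observations the convolution is controlled by Cauchy–Schwarz and Tonelli
(`C0Semigroup.lintegral_sq_conv_le`). As `h → 0`, `K L_h p(t) = K V_h η(t)` tends to `K η(t)`, and
Fatou's lemma keeps the bound (`C0Semigroup.exists_lintegral_sq_observation_le`).

This settles a short interval; the semigroup law of `𝒮*` and the invariance of `D(𝒜*)` carry the
estimate to every interval (`DelayAdmissible.add`). -/

/-! ## Semigroups, generators and resolvents -/

section Generator

variable {H : Type*} [NormedAddCommGroup H] [NormedSpace ℂ H]

namespace C0Semigroup

theorem mem_generator_graph (S : C0Semigroup H) {x y : H} :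
    (x, y) ∈ S.generator.graph ↔
      Tendsto (fun h : ℝ => ((h⁻¹ : ℝ) : ℂ) • (S.op h x - x)) (𝓝[>] 0) (𝓝 y) := by
  rw [generator, Submodule.toLinearPMap_graph_eq _ S.generatorGraph_single]
  rfl

theorem op_comm (S : C0Semigroup H) {s t : ℝ} (hs : 0 ≤ s) (ht : 0 ≤ t) (x : H) :
    S.op s (S.op t x) = S.op t (S.op s x) := by
  have h1 := S.op_add s t hs ht
  rw [add_comm, S.op_add t s ht hs] at h1
  exact (congrArg (fun L : H →L[ℂ] H => L x) h1).symm

theorem op_add_apply (S : C0Semigroup H) {s t : ℝ} (hs : 0 ≤ s) (ht : 0 ≤ t) (x : H) :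
    S.op (s + t) x = S.op s (S.op t x) := by
  rw [S.op_add s t hs ht]; rfl

/-- The semigroup preserves the graph of its generator. -/
theorem op_mem_graph (S : C0Semigroup H) {x y : H} (h : (x, y) ∈ S.generator.graph) {t : ℝ}
    (ht : 0 ≤ t) : (S.op t x, S.op t y) ∈ S.generator.graph := by
  rw [mem_generator_graph] at h ⊢
  refine (((S.op t).continuous.tendsto y).comp h).congr' ?_
  filter_upwards [self_mem_nhdsWithin] with s hs
  simp only [Function.comp_apply, map_smul, map_sub]
  rw [S.op_comm ht (le_of_lt hs)]

/-- The definition of the generator only gives a right derivative. That is enough for the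
fundamental theorem of calculus, since the orbit is continuous. -/
theorem hasDerivWithinAt_op (S : C0Semigroup H) {x y : H} (h : (x, y) ∈ S.generator.graph) {t : ℝ}
    (ht : 0 ≤ t) : HasDerivWithinAt (fun s => S.op s x) (S.op t y) (Ioi t) t := by
  have h1 := S.mem_generator_graph.1 (S.op_mem_graph h ht)
  rw [hasDerivWithinAt_iff_tendsto_slope' self_notMem_Ioi]
  have h2 : Tendsto (fun s => s - t) (𝓝[>] t) (𝓝[>] (0 : ℝ)) := by
    refine tendsto_nhdsWithin_iff.2 ⟨?_, ?_⟩
    · have : Tendsto (fun s : ℝ => s - t) (𝓝 t) (𝓝 (t - t)) := tendsto_id.sub_const t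
      rw [sub_self] at this
      exact this.mono_left nhdsWithin_le_nhds
    · filter_upwards [self_mem_nhdsWithin] with s hs
      exact mem_Ioi.2 (sub_pos.2 (mem_Ioi.1 hs))
  refine (h1.comp h2).congr' ?_
  filter_upwards [self_mem_nhdsWithin] with s hs
  simp only [Function.comp_apply, slope_def_module]
  rw [Complex.coe_smul, ← S.op_add_apply (sub_nonneg.2 (le_of_lt hs)) ht, sub_add_cancel]

theorem intervalIntegrable_op (S : C0Semigroup H) (x : H) {t : ℝ} (ht : 0 ≤ t) :
    IntervalIntegrable (fun s => S.op s x) volume 0 t := by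
  refine ContinuousOn.intervalIntegrable ((S.strongCont x).mono ?_)
  rw [uIcc_of_le ht]
  exact Icc_subset_Ici_self

theorem op_sub_self_eq_integral [CompleteSpace H] (S : C0Semigroup H) {x y : H}
    (h : (x, y) ∈ S.generator.graph) {t : ℝ} (ht : 0 ≤ t) :
    S.op t x - x = ∫ s in (0 : ℝ)..t, S.op s y := by
  rw [intervalIntegral.integral_eq_sub_of_hasDeriv_right (f := fun s => S.op s x) _ _
    (S.intervalIntegrable_op y ht)]
  · simp [S.op_zero]
  · rw [uIcc_of_le ht]
    exact (S.strongCont x).mono Icc_subset_Ici_self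
  · intro s hs
    rw [min_eq_left ht] at hs
    exact S.hasDerivWithinAt_op h hs.1.le

end C0Semigroup

end Generator

/-! ### Resolvents, domains of adjoints, and the bounded form of the control adjoint. -/

section Resolvent

variable {H : Type*} [NormedAddCommGroup H] [InnerProductSpace ℂ H] {A : H →ₗ.[ℂ] H} {z : ℂ}
  {R : H →L[ℂ] H}

namespace IsResolvent

theorem mem_graph (hR : IsResolvent A z R) (x : H) : (R x, z • R x - x) ∈ A.graph := by
  refine (LinearPMap.mem_graph_iff A).2 ⟨⟨R x, hR.mem x⟩, rfl, ?_⟩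
  rw [eq_sub_iff_add_eq, ← eq_sub_iff_add_eq']
  exact (hR.right x).symm

theorem apply_of_mem_graph (hR : IsResolvent A z R) {x y : H} (h : (x, y) ∈ A.graph) :
    R (z • x - y) = x := by
  obtain ⟨x', rfl, rfl⟩ := (LinearPMap.mem_graph_iff A).1 h
  exact hR.left x'

theorem comm_of_graph (hR : IsResolvent A z R) (L : H →L[ℂ] H)
    (hL : ∀ x y, (x, y) ∈ A.graph → (L x, L y) ∈ A.graph) (x : H) : R (L x) = L (R x) := by
  have h := hR.apply_of_mem_graph (hL _ _ (hR.mem_graph x))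
  simpa only [map_sub, map_smul, sub_sub_cancel] using h

theorem injective (hR : IsResolvent A z R) : Function.Injective R := by
  rw [injective_iff_map_eq_zero]
  intro x hx
  have h := (LinearPMap.mem_graph_iff A).1 (hR.mem_graph x)
  obtain ⟨x', h1, h2⟩ := h
  have : x' = 0 := Subtype.ext (by rw [h1, hx]; rfl)
  rw [this, LinearPMap.map_zero, hx, smul_zero, zero_sub] at h2
  exact neg_eq_zero.1 h2.symm

end IsResolvent

variable [CompleteSpace H]

/-- Hahn–Banach extends the bounded functional from `D(A)` to `H` before Riesz representation is
applied, so density of `D(A)` plays no role. The vector `w` need not be unique. -/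
theorem exists_inner_eq_of_mem_adjoint_domain {ψ : H} (hψ : ψ ∈ A†.domain) :
    ∃ w : H, ∀ x y, (x, y) ∈ A.graph → inner ℂ ψ y = inner ℂ w x := by
  have hc : Continuous ((innerₛₗ ℂ ψ).comp A.toFun) :=
    (LinearPMap.mem_adjoint_domain_iff A ψ).1 hψ
  let L : A.domain →L[ℂ] ℂ := ⟨(innerₛₗ ℂ ψ).comp A.toFun, hc⟩
  obtain ⟨g, hg, -⟩ := exists_extension_norm_eq A.domain L
  refine ⟨(InnerProductSpace.toDual ℂ H).symm g, fun x y h => ?_⟩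
  obtain ⟨x', rfl, rfl⟩ := (LinearPMap.mem_graph_iff A).1 h
  rw [InnerProductSpace.toDual_symm_apply, hg]
  rfl

theorem mem_adjoint_domain_of_inner {ψ w : H}
    (h : ∀ x y, (x, y) ∈ A.graph → inner ℂ ψ y = inner ℂ w x) : ψ ∈ A†.domain :=
  LinearPMap.mem_adjoint_domain_of_exists ψ
    ⟨w, fun x => (h x (A x) ((LinearPMap.mem_graph_iff A).2 ⟨x, rfl, rfl⟩)).symm⟩

/-- The domain of the adjoint is the range of the adjoint of the resolvent. -/
theorem IsResolvent.mem_adjoint_domain_iff (hR : IsResolvent A z R) {ψ : H} :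
    ψ ∈ A†.domain ↔ ∃ η, ContinuousLinearMap.adjoint R η = ψ := by
  constructor
  · intro hψ
    obtain ⟨w, hw⟩ := exists_inner_eq_of_mem_adjoint_domain hψ
    -- With `w` in the role of `A* ψ`, the preimage of `ψ` under `R*` is `(z̄ - A*) ψ`.
    refine ⟨(starRingEnd ℂ z) • ψ - w, ext_inner_right ℂ fun x => ?_⟩
    rw [ContinuousLinearMap.adjoint_inner_left, inner_sub_left, inner_smul_left,
      ← hw _ _ (hR.mem_graph x), inner_sub_right, inner_smul_right, Complex.conj_conj,
      sub_sub_cancel]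
  · rintro ⟨η, rfl⟩
    refine mem_adjoint_domain_of_inner (w := (starRingEnd ℂ z) • ContinuousLinearMap.adjoint R η - η)
      fun x y h => ?_
    rw [ContinuousLinearMap.adjoint_inner_left, inner_sub_left, inner_smul_left,
      ContinuousLinearMap.adjoint_inner_left, Complex.conj_conj, ← inner_smul_right,
      ← inner_sub_right]
    congr 1
    have h1 := hR.apply_of_mem_graph h
    rw [map_sub, map_smul] at h1
    rw [eq_sub_iff_add_eq, ← eq_sub_iff_add_eq', h1]

/-- If a bounded operator commutes with the resolvent, its adjoint preserves the domain of the
adjoint. -/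
theorem IsResolvent.adjoint_mem_adjoint_domain (hR : IsResolvent A z R) {L : H →L[ℂ] H}
    (hL : ∀ x, R (L x) = L (R x)) {ψ : H} (hψ : ψ ∈ A†.domain) :
    ContinuousLinearMap.adjoint L ψ ∈ A†.domain := by
  obtain ⟨η, rfl⟩ := hR.mem_adjoint_domain_iff.1 hψ
  refine hR.mem_adjoint_domain_iff.2 ⟨ContinuousLinearMap.adjoint L η,
    ext_inner_right ℂ fun x => ?_⟩
  simp only [ContinuousLinearMap.adjoint_inner_left, hL]

/-- The continuous extension of `(z I - A)⁻¹` to `H₋₁`. -/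
noncomputable def extrapResolvent (A : H →ₗ.[ℂ] H) (z : ℂ) : Extrap A z →L[ℂ] H :=
  ContinuousLinearMap.extend
    (((opResolvent A z : H →ₗ[ℂ] H) ∘ₗ PreExtrap.toH A z).mkContinuous 1
      fun f => (by rw [one_mul]; exact le_of_eq (PreExtrap.norm_def f).symm))
    (Extrap.incl A z)

theorem extrapResolvent_incl (f : PreExtrap A z) :
    extrapResolvent A z (Extrap.incl A z f) = opResolvent A z (PreExtrap.toH A z f) :=
  ContinuousLinearMap.extend_eq _ UniformSpace.Completion.denseRange_coe
    (UniformSpace.Completion.isUniformInducing_coe _) f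

/-- Both sides are continuous on `H₋₁` and agree on the dense subspace `H`, where this is the
definition of the adjoint of the resolvent. -/
theorem extrapPairing_adjoint_opResolvent (hz : z ∈ opResolventSet A) {ψ : A†.domain} {η : H}
    (h : ContinuousLinearMap.adjoint (opResolvent A z) η = ψ) (v : Extrap A z) :
    extrapPairing hz ψ v = inner ℂ η (extrapResolvent A z v) := by
  refine UniformSpace.Completion.induction_on v
    (isClosed_eq (extrapPairing hz ψ).continuous (by fun_prop)) fun f => ?_
  change extrapPairing hz ψ (Extrap.incl A z f) = inner ℂ η (extrapResolvent A z (Extrap.incl A z f))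
  rw [extrapPairing_incl, extrapResolvent_incl, ← h, ContinuousLinearMap.adjoint_inner_left]

variable {U : Type*} [NormedAddCommGroup U] [InnerProductSpace ℂ U] [CompleteSpace U]

/-- The key reduction: `B*` is unbounded, but its composition with the adjoint resolvent is the
adjoint of a bounded operator from `U` to `H`. -/
theorem controlAdjoint_adjoint_opResolvent (hz : z ∈ opResolventSet A) (B : U →L[ℂ] Extrap A z)
    (η : H) :
    controlAdjoint hz B (ContinuousLinearMap.adjoint (opResolvent A z) η) =
      ContinuousLinearMap.adjoint ((extrapResolvent A z).comp B) η := by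
  have hmem := (opResolvent_spec hz).mem_adjoint_domain_iff.2 ⟨η, rfl⟩
  refine ext_inner_right ℂ fun u => ?_
  rw [inner_controlAdjoint hz B ⟨_, hmem⟩ u, extrapPairing_adjoint_opResolvent hz (η := η) rfl,
    ContinuousLinearMap.adjoint_inner_left]
  rfl

end Resolvent

/-! ## The adjoint semigroup -/

section DualSemigroup

variable {H : Type*} [NormedAddCommGroup H] [InnerProductSpace ℂ H] [CompleteSpace H]

theorem norm_le_of_forall_inner_le {v : H} {C : ℝ} (hC : 0 ≤ C)
    (h : ∀ x : H, ‖(inner ℂ v x : ℂ)‖ ≤ C * ‖x‖) : ‖v‖ ≤ C := by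
  rw [← innerSL_apply_norm ℂ v]
  exact ContinuousLinearMap.opNorm_le_bound _ hC h

theorem intervalIntegral_inner_right {f : ℝ → H} {a b : ℝ} (hf : IntervalIntegrable f volume a b)
    (x : H) : inner ℂ x (∫ s in a..b, f s) = ∫ s in a..b, (inner ℂ x (f s) : ℂ) :=
  ((innerSL ℂ x).intervalIntegral_comp_comm hf).symm

theorem intervalIntegral_inner_left {f : ℝ → H} {a b : ℝ} (hf : IntervalIntegrable f volume a b)
    (x : H) : inner ℂ (∫ s in a..b, f s) x = ∫ s in a..b, (inner ℂ (f s) x : ℂ) := by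
  rw [← inner_conj_symm, intervalIntegral_inner_right hf]
  simp only [intervalIntegral, map_sub, ← integral_conj, inner_conj_symm]

/-- The closure of the range of `R*` is the orthogonal complement of the kernel of `R`, and `R` is
injective. -/
theorem IsResolvent.denseRange_adjoint {A : H →ₗ.[ℂ] H} {z : ℂ} {R : H →L[ℂ] H}
    (hR : IsResolvent A z R) : DenseRange (ContinuousLinearMap.adjoint R) := by
  have h := R.orthogonal_ker
  rw [LinearMap.ker_eq_bot.2 hR.injective, Submodule.bot_orthogonal_eq_top] at h
  exact (Submodule.dense_iff_topologicalClosure_eq_top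
    (s := (ContinuousLinearMap.adjoint R).range)).2 h.symm

namespace C0Semigroup

variable (S : C0Semigroup H) {z : ℂ} {R : H →L[ℂ] H}

theorem resolvent_comm (hR : IsResolvent S.generator z R) {t : ℝ} (ht : 0 ≤ t) (x : H) :
    R (S.op t x) = S.op t (R x) :=
  hR.comm_of_graph (S.op t) (fun _ _ h => S.op_mem_graph h ht) x

theorem adjoint_resolvent_comm (hR : IsResolvent S.generator z R) {t : ℝ} (ht : 0 ≤ t) (x : H) :
    ContinuousLinearMap.adjoint R (ContinuousLinearMap.adjoint (S.op t) x) =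
      ContinuousLinearMap.adjoint (S.op t) (ContinuousLinearMap.adjoint R x) := by
  refine ext_inner_right ℂ fun y => ?_
  simp only [ContinuousLinearMap.adjoint_inner_left, S.resolvent_comm hR ht]

/-- Orbits starting in `D(A)` are Lipschitz. Here the constant is linear in `‖x‖`, so the estimate
passes to the adjoint operators. -/
theorem norm_op_sub_op_resolvent_le (hR : IsResolvent S.generator z R) {M T : ℝ}
    (hM : ∀ t ∈ Icc 0 T, ‖S.op t‖ ≤ M) {s t : ℝ} (hs : s ∈ Icc 0 T) (ht : t ∈ Icc 0 T) (x : H) :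
    ‖S.op t (R x) - S.op s (R x)‖ ≤ M * ((‖z‖ * ‖R‖ + 1) * ‖x‖) * |t - s| := by
  have h : S.op t (R x) - S.op s (R x) = ∫ r in s..t, S.op r (z • R x - x) := by
    rw [← intervalIntegral.integral_interval_sub_left
      (S.intervalIntegrable_op _ ht.1) (S.intervalIntegrable_op _ hs.1),
      ← S.op_sub_self_eq_integral (hR.mem_graph x) ht.1,
      ← S.op_sub_self_eq_integral (hR.mem_graph x) hs.1, sub_sub_sub_cancel_right]
  rw [h]
  refine intervalIntegral.norm_integral_le_of_norm_le_const fun r hr => ?_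
  have hr' := uIcc_subset_Icc hs ht (uIoc_subset_uIcc hr)
  refine (S.op r).le_of_opNorm_le_of_le (hM r hr') ?_
  refine (norm_sub_le _ _).trans ?_
  rw [norm_smul, add_mul, one_mul, mul_assoc]
  gcongr
  exact R.le_opNorm x

/-- By duality with the previous estimate, adjoint orbits starting in the range of `R*` are
Lipschitz on bounded intervals. That range is dense and the operators are bounded there uniformly,
so every adjoint orbit is a locally uniform limit of continuous ones. -/
theorem continuousOn_adjoint (hR : IsResolvent S.generator z R) (ψ : H) :
    ContinuousOn (fun t => ContinuousLinearMap.adjoint (S.op t) ψ) (Ici 0) := by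
  have key : ∀ T : ℝ, ContinuousOn (fun t => ContinuousLinearMap.adjoint (S.op t) ψ) (Icc 0 T) := by
    intro T
    obtain ⟨M, hM0, hM⟩ := S.exists_bound T
    refine continuousOn_of_uniform_approx_of_continuousOn fun u hu => ?_
    obtain ⟨ε, hε, hεu⟩ := Metric.mem_uniformity_dist.1 hu
    obtain ⟨η, hη⟩ := hR.denseRange_adjoint.exists_dist_lt ψ
      -- `M + 1` rather than `M`, since the bound `M` may be zero.
      (show 0 < ε / (M + 1) by positivity)
    refine ⟨fun t => ContinuousLinearMap.adjoint (S.op t) (ContinuousLinearMap.adjoint R η), ?_,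
      fun t ht => hεu ?_⟩
    · have hL : LipschitzOnWith (Real.toNNReal (M * (‖z‖ * ‖R‖ + 1) * ‖η‖))
          (fun t => ContinuousLinearMap.adjoint (S.op t) (ContinuousLinearMap.adjoint R η))
          (Icc 0 T) := by
        refine LipschitzOnWith.of_dist_le_mul fun t ht s hs => ?_
        rw [dist_eq_norm, Real.coe_toNNReal _ (by positivity), Real.dist_eq]
        refine norm_le_of_forall_inner_le (by positivity) fun x => ?_
        rw [inner_sub_left]
        simp only [ContinuousLinearMap.adjoint_inner_left, S.resolvent_comm hR ht.1,
          S.resolvent_comm hR hs.1]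
        rw [← inner_sub_right]
        refine (norm_inner_le_norm _ _).trans ?_
        refine (mul_le_mul_of_nonneg_left (S.norm_op_sub_op_resolvent_le hR hM hs ht x)
          (norm_nonneg η)).trans (le_of_eq (by ring))
      exact hL.continuousOn
    · rw [dist_eq_norm, ← map_sub]
      refine ((ContinuousLinearMap.adjoint (S.op t)).le_of_opNorm_le
        ((LinearIsometryEquiv.norm_map _ _).trans_le (hM t ht)) _).trans_lt ?_
      rw [← dist_eq_norm]
      rw [lt_div_iff₀ (by positivity)] at hη
      nlinarith [dist_nonneg (x := ψ) (y := ContinuousLinearMap.adjoint R η)]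
  intro t ht
  refine (key (t + 1) t ⟨ht, by linarith⟩).mono_of_mem_nhdsWithin ?_
  rw [← Ici_inter_Iic]
  exact inter_mem self_mem_nhdsWithin (mem_nhdsWithin_of_mem_nhds (Iic_mem_nhds (by linarith)))

/-- The adjoint semigroup `S*`. -/
noncomputable def dual (hR : IsResolvent S.generator z R) : C0Semigroup H where
  op t := ContinuousLinearMap.adjoint (S.op t)
  op_zero := by
    rw [S.op_zero]
    exact ContinuousLinearMap.adjoint_id
  op_add s t hs ht := by
    rw [add_comm, S.op_add t s ht hs]
    exact ContinuousLinearMap.adjoint_comp _ _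
  strongCont := S.continuousOn_adjoint hR

theorem dual_op (hR : IsResolvent S.generator z R) (t : ℝ) :
    (S.dual hR).op t = ContinuousLinearMap.adjoint (S.op t) := rfl

/-- The integrated form of `A* R* = z̄ R* - 1`. It is all that the later estimate needs of the
generator of the adjoint semigroup, which is never identified. -/
theorem dual_op_sub_self_eq_integral (hR : IsResolvent S.generator z R) {t : ℝ} (ht : 0 ≤ t)
    (ψ : H) :
    (S.dual hR).op t (ContinuousLinearMap.adjoint R ψ) - ContinuousLinearMap.adjoint R ψ =
      ∫ s in (0 : ℝ)..t, (S.dual hR).op s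
        ((starRingEnd ℂ z) • ContinuousLinearMap.adjoint R ψ - ψ) := by
  refine ext_inner_right ℂ fun x => ?_
  rw [intervalIntegral_inner_left ((S.dual hR).intervalIntegrable_op _ ht), inner_sub_left]
  simp only [dual_op, ContinuousLinearMap.adjoint_inner_left]
  rw [S.resolvent_comm hR ht, ← inner_sub_right,
    S.op_sub_self_eq_integral (hR.mem_graph x) ht,
    intervalIntegral_inner_right (S.intervalIntegrable_op _ ht)]
  refine intervalIntegral.integral_congr fun s hs => ?_
  rw [uIcc_of_le ht] at hs
  rw [inner_sub_left, inner_smul_left, Complex.conj_conj, ContinuousLinearMap.adjoint_inner_left,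
    S.resolvent_comm hR hs.1, ← inner_smul_right, ← inner_sub_right, map_sub, map_smul]

end C0Semigroup

end DualSemigroup

/-! ## Averages of a semigroup -/

section Average

variable {H : Type*} [NormedAddCommGroup H] [InnerProductSpace ℂ H] [CompleteSpace H]

namespace C0Semigroup

variable (T : C0Semigroup H)

/-- The operators at negative times are arbitrary. Clamping the time at `0` gives a function
continuous on the whole line, so its integrals need no side conditions. -/
theorem continuous_op_max (x : H) : Continuous (fun t : ℝ => T.op (max t 0) x) :=
  (T.strongCont x).comp_continuous (by fun_prop) (fun t => mem_Ici.2 (le_max_right _ _))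

theorem norm_integral_op_le {M b h : ℝ} (hM : ∀ t ∈ Icc 0 b, ‖T.op t‖ ≤ M) (hb : |h| ≤ b) (x : H) :
    ‖∫ s in (0 : ℝ)..h, T.op (max s 0) x‖ ≤ M * ‖x‖ * |h| := by
  have h1 := intervalIntegral.norm_integral_le_of_norm_le_const (a := 0) (b := h)
    (f := fun s => T.op (max s 0) x) (C := M * ‖x‖) fun s hs => ?_
  · rwa [sub_zero] at h1
  · have h2 : |s| ≤ |h| := by simpa using abs_sub_left_of_mem_uIcc (uIoc_subset_uIcc hs)
    exact (T.op _).le_of_opNorm_le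
      (hM _ ⟨le_max_right _ _, max_le ((le_abs_self s).trans (h2.trans hb))
        ((abs_nonneg h).trans hb)⟩) x

/-- The average `h⁻¹ ∫₀ʰ T(s) ds`. -/
noncomputable def average (h : ℝ) : H →L[ℂ] H :=
  LinearMap.mkContinuousOfExistsBound
    { toFun := fun x => ((h⁻¹ : ℝ) : ℂ) • ∫ s in (0 : ℝ)..h, T.op (max s 0) x
      map_add' := fun x y => by
        simp only [map_add]
        rw [intervalIntegral.integral_add ((T.continuous_op_max x).intervalIntegrable _ _)
          ((T.continuous_op_max y).intervalIntegrable _ _), smul_add]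
      map_smul' := fun c x => by
        simp only [map_smul, intervalIntegral.integral_smul, RingHom.id_apply]
        rw [smul_comm] }
    (by
      obtain ⟨M, hM0, hM⟩ := T.exists_bound |h|
      refine ⟨|h⁻¹| * (M * |h|), fun x => ?_⟩
      change ‖((h⁻¹ : ℝ) : ℂ) • ∫ s in (0 : ℝ)..h, T.op (max s 0) x‖ ≤ _
      rw [norm_smul, Complex.norm_real, Real.norm_eq_abs, mul_assoc]
      exact mul_le_mul_of_nonneg_left ((T.norm_integral_op_le hM le_rfl x).trans
        (le_of_eq (by ring))) (abs_nonneg _))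

theorem average_apply (h : ℝ) (x : H) :
    T.average h x = ((h⁻¹ : ℝ) : ℂ) • ∫ s in (0 : ℝ)..h, T.op (max s 0) x := rfl

theorem exists_average_bound :
    ∃ M : ℝ, 0 ≤ M ∧ ∀ h ∈ Ioc (0 : ℝ) 1, ∀ x, ‖T.average h x‖ ≤ M * ‖x‖ := by
  obtain ⟨M, hM0, hM⟩ := T.exists_bound 1
  refine ⟨M, hM0, fun h hh x => ?_⟩
  have h1 := T.norm_integral_op_le hM (h := h) (by rw [abs_of_pos hh.1]; exact hh.2) x
  rw [average_apply, norm_smul, Complex.norm_real, Real.norm_eq_abs, abs_inv,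
    inv_mul_le_iff₀ (abs_pos.2 hh.1.ne')]
  linarith

theorem tendsto_average (x : H) : Tendsto (fun h => T.average h x) (𝓝[>] 0) (𝓝 x) := by
  have h1 := ((T.continuous_op_max x).integral_hasStrictDerivAt 0 0).hasDerivAt
  have h2 := (hasDerivAt_iff_tendsto_slope_zero.1 h1).mono_left
    (nhdsWithin_mono (0 : ℝ) (show Ioi (0 : ℝ) ⊆ {0}ᶜ from fun s hs => (mem_Ioi.1 hs).ne'))
  simpa [T.op_zero, average_apply, ← Complex.ofReal_inv, Complex.coe_smul] using h2

theorem average_comm {L : H →L[ℂ] H} (hL : ∀ t, 0 ≤ t → ∀ x, L (T.op t x) = T.op t (L x))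
    (h : ℝ) (x : H) : L (T.average h x) = T.average h (L x) := by
  rw [average_apply, average_apply, map_smul,
    ← L.intervalIntegral_comp_comm ((T.continuous_op_max x).intervalIntegrable _ _)]
  simp only [hL _ (le_max_right _ _)]

/-- If `R = (c I - A)⁻¹` for the generator `A` of `T`, this is the bounded operator
`(c I - A) h⁻¹ ∫₀ʰ T(s) ds`. -/
noncomputable def averageInverse (c : ℂ) (h : ℝ) : H →L[ℂ] H :=
  c • T.average h - ((h⁻¹ : ℝ) : ℂ) • (T.op h - 1)

theorem averageInverse_comm {L : H →L[ℂ] H} (hL : ∀ t, 0 ≤ t → ∀ x, L (T.op t x) = T.op t (L x))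
    (c : ℂ) {h : ℝ} (hh : 0 ≤ h) (x : H) :
    L (T.averageInverse c h x) = T.averageInverse c h (L x) := by
  simp [averageInverse, T.average_comm hL, hL h hh]

/-- This justifies the name: `averageInverse` undoes the resolvent up to averaging, hence
approximates `R⁻¹` on the range of `R` while being bounded on all of `H`. -/
theorem averageInverse_resolvent {R : H →L[ℂ] H} {c : ℂ}
    (hR : ∀ t, 0 ≤ t → ∀ x, T.op t (R x) - R x = ∫ s in (0 : ℝ)..t, T.op s (c • R x - x))
    {h : ℝ} (hh : 0 ≤ h) (x : H) : T.averageInverse c h (R x) = T.average h x := by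
  have e : ∫ s in (0 : ℝ)..h, T.op s (c • R x - x) =
      ∫ s in (0 : ℝ)..h, T.op (max s 0) (c • R x - x) := by
    refine intervalIntegral.integral_congr fun s hs => ?_
    rw [uIcc_of_le hh] at hs
    simp only [max_eq_left hs.1]
  have e2 : ((h⁻¹ : ℝ) : ℂ) • (T.op h (R x) - R x) = T.average h (c • R x - x) := by
    rw [hR h hh, e, average_apply]
  change c • T.average h (R x) - ((h⁻¹ : ℝ) : ℂ) • (T.op h (R x) - R x) = _
  rw [e2, map_sub, map_smul, sub_sub_cancel]

end C0Semigroup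

end Average

/-! ## Square integrability of observed convolutions -/

section Estimate

/-- Cauchy–Schwarz against the constant function `1`. -/
theorem sq_lintegral_le {α : Type*} [MeasurableSpace α] (μ : Measure α) {f : α → ENNReal}
    (hf : AEMeasurable f μ) : (∫⁻ s, f s ∂μ) ^ 2 ≤ μ univ * ∫⁻ s, f s ^ 2 ∂μ := by
  have h := ENNReal.lintegral_mul_le_Lp_mul_Lq μ Real.HolderConjugate.two_two
    (f := fun _ => 1) aemeasurable_const hf
  simp only [Pi.mul_apply, one_mul, ENNReal.rpow_ofNat, one_pow, lintegral_one] at h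
  refine (pow_le_pow_left' h 2).trans (le_of_eq ?_)
  have e : ∀ x : ENNReal, (x ^ (1 / 2 : ℝ)) ^ 2 = x := fun x => by
    rw [← ENNReal.rpow_natCast, ← ENNReal.rpow_mul]
    norm_num
  rw [mul_pow, e, e]

variable {H U : Type*} [NormedAddCommGroup H] [InnerProductSpace ℂ H] [CompleteSpace H]
  [NormedAddCommGroup U] [NormedSpace ℂ U] [CompleteSpace U]

/-- Cauchy–Schwarz in `s` costs the factor `a`. After Tonelli, for fixed `s` the inner integral over
`t` is, up to the shift by `s`, part of the observed orbit of the vector `g s`, to which `hW`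
applies. The norm of `W` does not enter, which is what permits unbounded limits later. -/
theorem C0Semigroup.lintegral_sq_conv_le (T : C0Semigroup H) (W : H →L[ℂ] U) {a : ℝ}
    {c : ENNReal} (hW : ∀ ψ, ∫⁻ t in Ioc 0 a, ‖W (T.op t ψ)‖ₑ ^ 2 ≤ c * ‖ψ‖ₑ ^ 2)
    {g : ℝ → H} (hg : IntegrableOn g (Ioc 0 a)) :
    ∫⁻ t in Ioc 0 a, ‖W (∫ s in (0 : ℝ)..t, T.op (t - s) (g s))‖ₑ ^ 2 ≤
      ENNReal.ofReal a * c * ∫⁻ s in Ioc 0 a, ‖g s‖ₑ ^ 2 := by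
  set μ : Measure ℝ := volume.restrict (Ioc 0 a) with hμ
  -- The squared integrand, cut off to the triangle `s ≤ t` and with clamped time, so that it is
  -- defined and measurable on the whole square.
  set F : ℝ → ℝ → ENNReal := fun t s =>
    (Ici s).indicator (fun _ => ‖W (T.op (max (t - s) 0) (g s))‖ₑ ^ 2) t with hF
  have hjoint : AEStronglyMeasurable (fun p : ℝ × ℝ => W (T.op (max (p.1 - p.2) 0) (g p.2)))
      (μ.prod μ) := by
    refine W.continuous.comp_aestronglyMeasurable (T.continuous_joint.comp_aestronglyMeasurable
      (f := fun p : ℝ × ℝ => (p.1 - p.2, g p.2)) ?_)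
    exact (Continuous.aestronglyMeasurable (by fun_prop)).prodMk
      (hg.aestronglyMeasurable.comp_snd)
  have hFm : AEMeasurable (Function.uncurry F) (μ.prod μ) := by
    have : Function.uncurry F = {p : ℝ × ℝ | p.2 ≤ p.1}.indicator
        (fun p => ‖W (T.op (max (p.1 - p.2) 0) (g p.2))‖ₑ ^ 2) := by
      ext p
      simp only [hF, Function.uncurry, indicator, mem_Ici, mem_ofPred_eq]
    rw [this]
    exact (hjoint.enorm.pow_const 2).indicator (measurableSet_le measurable_snd measurable_fst)
  have hpt : ∀ t ∈ Ioc 0 a, ‖W (∫ s in (0 : ℝ)..t, T.op (t - s) (g s))‖ₑ ^ 2 ≤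
      ENNReal.ofReal a * ∫⁻ s, F t s ∂μ := by
    intro t ht
    have hgt : IntegrableOn g (Ioc 0 t) := hg.mono_set (Ioc_subset_Ioc_right ht.2)
    have e : ∫⁻ s in Ioc 0 t, ‖W (T.op (max (t - s) 0) (g s))‖ₑ ^ 2 ≤ ∫⁻ s, F t s ∂μ := by
      refine (setLIntegral_congr_fun measurableSet_Ioc fun s hs => ?_).trans_le
        (lintegral_mono' (Measure.restrict_mono (Ioc_subset_Ioc_right ht.2) le_rfl) le_rfl)
      simp only [hF, indicator_of_mem (mem_Ici.2 hs.2)]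
    rw [← W.intervalIntegral_comp_comm (T.intervalIntegrable_conv g ht.1.le hgt),
      intervalIntegral.integral_of_le ht.1.le]
    have h1 : ‖∫ s in Ioc 0 t, W (T.op (t - s) (g s))‖ₑ ≤
        ∫⁻ s in Ioc 0 t, ‖W (T.op (max (t - s) 0) (g s))‖ₑ := by
      refine (enorm_integral_le_lintegral_enorm _).trans_eq
        (setLIntegral_congr_fun measurableSet_Ioc fun s hs => ?_)
      simp only [max_eq_left (sub_nonneg.2 hs.2)]
    refine (pow_le_pow_left' h1 2).trans ((sq_lintegral_le _ ?_).trans ?_)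
    · exact (W.continuous.comp_aestronglyMeasurable
        (T.aesm_conv g t hgt.aestronglyMeasurable)).enorm
    · rw [Measure.restrict_apply_univ, Real.volume_Ioc, sub_zero]
      exact mul_le_mul' (ENNReal.ofReal_le_ofReal ht.2) e
  have hin : ∀ s ∈ Ioc 0 a, ∫⁻ t, F t s ∂μ ≤ c * ‖g s‖ₑ ^ 2 := by
    intro s hs
    refine le_trans ?_ (hW (g s))
    -- Closed intervals are used because the shifted condition `s ≤ r + s` gives only `0 ≤ r`.
    rw [hμ, setLIntegral_congr (Ioc_ae_eq_Icc (α := ℝ) (μ := volume) (a := 0) (b := a)),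
      setLIntegral_congr (Ioc_ae_eq_Icc (α := ℝ) (μ := volume) (a := 0) (b := a)),
      ← lintegral_indicator measurableSet_Icc, ← lintegral_indicator measurableSet_Icc,
      ← lintegral_add_right_eq_self _ s]
    refine lintegral_mono fun r => ?_
    by_cases hr : r + s ∈ Icc 0 a ∧ s ≤ r + s
    · have hr0 : 0 ≤ r := by linarith [hr.2]
      rw [indicator_of_mem hr.1, indicator_of_mem (show r ∈ Icc 0 a from
        ⟨hr0, by linarith [hr.1.2, hs.1]⟩), hF]
      simp only
      rw [indicator_of_mem (mem_Ici.2 hr.2), add_sub_cancel_right, max_eq_left hr0]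
    · refine le_of_eq_of_le ?_ zero_le
      by_cases h1 : r + s ∈ Icc 0 a
      · rw [indicator_of_mem h1]
        exact indicator_of_notMem (fun h2 => hr ⟨h1, h2⟩) _
      · exact indicator_of_notMem h1 _
  calc ∫⁻ t in Ioc 0 a, ‖W (∫ s in (0 : ℝ)..t, T.op (t - s) (g s))‖ₑ ^ 2
      ≤ ∫⁻ t in Ioc 0 a, ENNReal.ofReal a * ∫⁻ s, F t s ∂μ :=
        setLIntegral_mono' measurableSet_Ioc hpt
    _ = ENNReal.ofReal a * ∫⁻ t, ∫⁻ s, F t s ∂μ ∂μ :=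
        lintegral_const_mul' _ _ ENNReal.ofReal_ne_top
    _ = ENNReal.ofReal a * ∫⁻ s, ∫⁻ t, F t s ∂μ ∂μ := by
        rw [lintegral_lintegral_swap hFm]
    _ ≤ ENNReal.ofReal a * ∫⁻ s in Ioc 0 a, c * ‖g s‖ₑ ^ 2 := by
        exact mul_le_mul' le_rfl (setLIntegral_mono' measurableSet_Ioc hin)
    _ = ENNReal.ofReal a * c * ∫⁻ s in Ioc 0 a, ‖g s‖ₑ ^ 2 := by
        rw [lintegral_const_mul'' _ (hg.aestronglyMeasurable.enorm.pow_const 2), mul_assoc]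

end Estimate

/-! ### Unbounded observations of mild solutions. -/

section ObservedConvolution

variable {H U : Type*} [NormedAddCommGroup H] [InnerProductSpace ℂ H] [CompleteSpace H]
  [NormedAddCommGroup U] [NormedSpace ℂ U] [CompleteSpace U]

theorem enorm_add_sq_le (u v : U) : ‖u + v‖ₑ ^ 2 ≤ 2 * (‖u‖ₑ ^ 2 + ‖v‖ₑ ^ 2) := by
  simp only [enorm_eq_nnnorm]
  exact_mod_cast (pow_le_pow_left' (nnnorm_add_le u v) 2).trans add_sq_le

namespace C0Semigroup

theorem continuousOn_mild (T : C0Semigroup H) {a : ℝ} (ψ : H) {g : ℝ → H}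
    (hg : IntegrableOn g (Ioc 0 a)) :
    ContinuousOn (fun t => T.op t ψ + ∫ s in (0 : ℝ)..t, T.op (t - s) (g s)) (Icc 0 a) := by
  refine ((T.strongCont ψ).mono Icc_subset_Ici_self).add ?_
  refine (T.continuousOn_conv ((Ioc 0 a).indicator g) a
    (hg.integrable_indicator measurableSet_Ioc)).congr fun t ht => ?_
  refine intervalIntegral.integral_congr_ae (Eventually.of_forall fun s hs => ?_)
  rw [uIoc_of_le ht.1] at hs
  rw [indicator_of_mem (show s ∈ Ioc 0 a from ⟨hs.1, hs.2.trans ht.2⟩)]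

/-- Suppose that `K R⁻¹` is an admissible observation for `T`, where `R = (c I - A)⁻¹`. Then the
observation of a mild solution which takes its values in `D(A)` is square integrable, with a bound
that involves neither the derivative of the inhomogeneity nor its values in `D(A)`. -/
theorem exists_lintegral_sq_observation_le (T : C0Semigroup H) {R : H →L[ℂ] H} {c : ℂ}
    (hcomm : ∀ t, 0 ≤ t → ∀ x, R (T.op t x) = T.op t (R x))
    (hR : ∀ t, 0 ≤ t → ∀ x, T.op t (R x) - R x = ∫ s in (0 : ℝ)..t, T.op s (c • R x - x))
    (K : H →L[ℂ] U) {a : ℝ} {C : NNReal}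
    (hK : ∀ η, ∫⁻ t in Ioc 0 a, ‖K (T.op t η)‖ₑ ^ 2 ≤ C * ‖R η‖ₑ ^ 2) :
    ∃ C' : NNReal, ∀ (ψ : H) (g η : ℝ → H), IntegrableOn g (Ioc 0 a) →
      (∀ t ∈ Ioc 0 a, R (η t) = T.op t ψ + ∫ s in (0 : ℝ)..t, T.op (t - s) (g s)) →
      AEStronglyMeasurable (fun t => K (η t)) (volume.restrict (Ioc 0 a)) ∧
      ∫⁻ t in Ioc 0 a, ‖K (η t)‖ₑ ^ 2 ≤ C' * (‖ψ‖ₑ ^ 2 + ∫⁻ s in Ioc 0 a, ‖g s‖ₑ ^ 2) := by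
  obtain ⟨M, hM0, hM⟩ := T.exists_average_bound
  set c₁ : NNReal := C * M.toNNReal ^ 2 with hc₁
  -- The uniform estimate. Moving `averageInverse` past the semigroup puts it on the initial vector,
  -- where `hK` yields the norm of `R` applied to it, that is of the average of `ψ`.
  have hW : ∀ h ∈ Ioc (0 : ℝ) 1, ∀ ψ,
      ∫⁻ t in Ioc 0 a, ‖(K.comp (T.averageInverse c h)) (T.op t ψ)‖ₑ ^ 2 ≤ c₁ * ‖ψ‖ₑ ^ 2 := by
    intro h hh ψ
    have e : ∀ t ∈ Ioc 0 a, ‖(K.comp (T.averageInverse c h)) (T.op t ψ)‖ₑ ^ 2 =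
        ‖K (T.op t (T.averageInverse c h ψ))‖ₑ ^ 2 := fun t ht => by
      rw [T.averageInverse_comm (fun s hs x => T.op_comm ht.1.le hs x) c hh.1.le]
      rfl
    rw [setLIntegral_congr_fun measurableSet_Ioc e]
    refine (hK _).trans ?_
    rw [T.averageInverse_comm hcomm c hh.1.le, T.averageInverse_resolvent hR hh.1.le, hc₁,
      ENNReal.coe_mul, mul_assoc, ENNReal.coe_pow, ← mul_pow]
    gcongr
    rw [enorm_eq_nnnorm, enorm_eq_nnnorm, ← ENNReal.coe_mul, ENNReal.coe_le_coe,
      ← NNReal.coe_le_coe]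
    simpa [hM0] using hM h hh ψ
  -- The factor `2` comes from the square of a sum, `c₁` from the orbit of `ψ`, and `a c₁` from the
  -- convolution.
  refine ⟨2 * (c₁ + a.toNNReal * c₁), fun ψ g η hg hη => ?_⟩
  set p : ℝ → H := fun t => T.op t ψ + ∫ s in (0 : ℝ)..t, T.op (t - s) (g s) with hp
  set h : ℕ → ℝ := fun n => 1 / ((n : ℝ) + 1) with hh
  have hmem : ∀ n, h n ∈ Ioc (0 : ℝ) 1 := fun n =>
    ⟨by positivity, by rw [hh, div_le_one (by positivity)]; linarith [Nat.cast_nonneg (α := ℝ) n]⟩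
  have hlim : Tendsto h atTop (𝓝[>] 0) :=
    tendsto_nhdsWithin_iff.2 ⟨tendsto_one_div_add_atTop_nhds_zero_nat,
      Eventually.of_forall fun n => (hmem n).1⟩
  set W : ℕ → H →L[ℂ] U := fun n => K.comp (T.averageInverse c (h n)) with hWdef
  have hWm : ∀ n, AEStronglyMeasurable (fun t => W n (p t)) (volume.restrict (Ioc 0 a)) := fun n =>
    (((W n).continuous.comp_continuousOn (T.continuousOn_mild ψ hg)).mono
      Ioc_subset_Icc_self).aestronglyMeasurable measurableSet_Ioc
  -- This uses that `p t = R (η t)`: the regularised observation of `p t` is `K` applied to an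
  -- average of `η t`. It also yields measurability of `t ↦ K (η t)`, with nothing assumed on how
  -- `η` depends on `t`.
  have hWlim : ∀ t ∈ Ioc 0 a, Tendsto (fun n => W n (p t)) atTop (𝓝 (K (η t))) := by
    intro t ht
    refine ((K.continuous.tendsto _).comp ((T.tendsto_average (η t)).comp hlim)).congr fun n => ?_
    simp only [Function.comp_apply, hWdef, ContinuousLinearMap.comp_apply, hp]
    rw [← hη t ht, T.averageInverse_resolvent hR (hmem n).1.le]
  have hlim_ae : ∀ᵐ t ∂volume.restrict (Ioc 0 a),
      Tendsto (fun n => W n (p t)) atTop (𝓝 (K (η t))) := by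
    filter_upwards [ae_restrict_mem measurableSet_Ioc] with t ht using hWlim t ht
  refine ⟨aestronglyMeasurable_of_tendsto_ae atTop hWm hlim_ae, ?_⟩
  have hbound : ∀ n, ∫⁻ t in Ioc 0 a, ‖W n (p t)‖ₑ ^ 2 ≤
      ((2 * (c₁ + a.toNNReal * c₁) : NNReal) : ENNReal) *
        (‖ψ‖ₑ ^ 2 + ∫⁻ s in Ioc 0 a, ‖g s‖ₑ ^ 2) := by
    intro n
    have h1 := hW (h n) (hmem n) ψ
    have h2 := T.lintegral_sq_conv_le (W n) (hW (h n) (hmem n)) hg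
    have hm : AEMeasurable (fun t => ‖W n (T.op t ψ)‖ₑ ^ 2) (volume.restrict (Ioc 0 a)) :=
      ((((W n).continuous.comp_continuousOn (T.strongCont ψ)).mono
        (Ioc_subset_Icc_self.trans Icc_subset_Ici_self)).aestronglyMeasurable
          measurableSet_Ioc).enorm.pow_const 2
    calc ∫⁻ t in Ioc 0 a, ‖W n (p t)‖ₑ ^ 2
        ≤ ∫⁻ t in Ioc 0 a, 2 * (‖W n (T.op t ψ)‖ₑ ^ 2 +
            ‖W n (∫ s in (0 : ℝ)..t, T.op (t - s) (g s))‖ₑ ^ 2) := by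
          refine lintegral_mono fun t => ?_
          simp only [hp, map_add]
          exact enorm_add_sq_le _ _
      _ = 2 * ((∫⁻ t in Ioc 0 a, ‖W n (T.op t ψ)‖ₑ ^ 2) +
            ∫⁻ t in Ioc 0 a, ‖W n (∫ s in (0 : ℝ)..t, T.op (t - s) (g s))‖ₑ ^ 2) := by
          rw [lintegral_const_mul' _ _ (by norm_num), lintegral_add_left' hm]
      _ ≤ 2 * (c₁ * ‖ψ‖ₑ ^ 2 + ENNReal.ofReal a * c₁ * ∫⁻ s in Ioc 0 a, ‖g s‖ₑ ^ 2) := by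
          gcongr
      _ ≤ _ := by
          push_cast
          rw [mul_assoc (2 : ENNReal), ENNReal.ofReal]
          refine mul_le_mul' le_rfl ?_
          rw [mul_add]
          refine add_le_add (mul_le_mul' le_self_add le_rfl) (mul_le_mul' le_add_self le_rfl)
  -- Fatou's lemma along `h n → 0`.
  calc ∫⁻ t in Ioc 0 a, ‖K (η t)‖ₑ ^ 2
      = ∫⁻ t in Ioc 0 a, liminf (fun n => ‖W n (p t)‖ₑ ^ 2) atTop := by
        refine lintegral_congr_ae ?_
        filter_upwards [hlim_ae] with t ht
        exact (((ENNReal.continuous_pow 2).tendsto _).comp ht.enorm).liminf_eq.symm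
    _ ≤ liminf (fun n => ∫⁻ t in Ioc 0 a, ‖W n (p t)‖ₑ ^ 2) atTop :=
        lintegral_liminf_le' fun n => (hWm n).enorm.pow_const 2
    _ ≤ _ := by
        refine (liminf_le_liminf (Eventually.of_forall hbound)).trans_eq ?_
        exact liminf_const _

end C0Semigroup

end ObservedConvolution

/-! ## Convolutions -/

section Convolution

/-- Fubini on the square for the integrand cut off to the triangle `s ≤ r`. -/
theorem integral_triangle_swap {E : Type*} [NormedAddCommGroup E] [NormedSpace ℝ E]
    {f : ℝ → ℝ → E} {t : ℝ} (ht : 0 ≤ t)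
    (hf : Integrable (Function.uncurry f)
      ((volume.restrict (Ioc 0 t)).prod (volume.restrict (Ioc 0 t)))) :
    ∫ r in (0 : ℝ)..t, ∫ s in (0 : ℝ)..r, f r s = ∫ s in (0 : ℝ)..t, ∫ r in s..t, f r s := by
  set G : ℝ → ℝ → E := fun r s => (Iic r).indicator (f r) s with hG
  have hGi : Integrable (Function.uncurry G)
      ((volume.restrict (Ioc 0 t)).prod (volume.restrict (Ioc 0 t))) := by
    have : Function.uncurry G = {p : ℝ × ℝ | p.2 ≤ p.1}.indicator (Function.uncurry f) := by
      ext p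
      simp only [hG, Function.uncurry, indicator, mem_Iic, mem_ofPred_eq]
    rw [this]
    exact hf.indicator (measurableSet_le measurable_snd measurable_fst)
  have h := integral_integral_swap hGi
  rw [intervalIntegral.integral_of_le ht, intervalIntegral.integral_of_le ht]
  convert h using 1
  · refine setIntegral_congr_fun measurableSet_Ioc fun r hr => ?_
    simp only [hG]
    rw [setIntegral_indicator measurableSet_Iic, intervalIntegral.integral_of_le hr.1.le,
      Ioc_inter_Iic, min_eq_right hr.2]
  · refine setIntegral_congr_fun measurableSet_Ioc fun s hs => ?_
    have e : (fun r => G r s) = (Ici s).indicator (fun r => f r s) := by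
      ext r
      simp only [hG, indicator, mem_Iic, mem_Ici]
    have e2 : Ioc 0 t ∩ Ici s = Icc s t := by
      ext r
      simp only [mem_inter_iff, mem_Ioc, mem_Ici, mem_Icc]
      exact ⟨fun h => ⟨h.2, h.1.2⟩, fun h => ⟨⟨hs.1.trans_le h.1, h.2⟩, h.1⟩⟩
    simp only [e]
    rw [setIntegral_indicator measurableSet_Ici, intervalIntegral.integral_of_le hs.2, e2,
      integral_Icc_eq_integral_Ioc]

/-- The integrand may depend on `h` as well, as needed for averages of `S(h - q) f(q)`. -/
theorem tendsto_average_of_continuous {E : Type*} [NormedAddCommGroup E] [NormedSpace ℝ E]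
    [CompleteSpace E] {F : ℝ × ℝ → E} (hF : Continuous F) :
    Tendsto (fun h : ℝ => h⁻¹ • ∫ q in (0 : ℝ)..h, F (h, q)) (𝓝[>] 0) (𝓝 (F (0, 0))) := by
  rw [Metric.tendsto_nhdsWithin_nhds]
  intro ε hε
  obtain ⟨δ, hδ, hd⟩ := Metric.continuous_iff.1 hF (0, 0) (ε / 2) (by positivity)
  refine ⟨δ, hδ, fun h hh hd' => ?_⟩
  have hh : 0 < h := hh
  rw [Real.dist_eq, sub_zero, abs_of_pos hh] at hd'
  have hi : IntervalIntegrable (fun q => F (h, q)) volume 0 h :=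
    Continuous.intervalIntegrable (by fun_prop) _ _
  have e : (h⁻¹ • ∫ q in (0 : ℝ)..h, F (h, q)) - F (0, 0) =
      h⁻¹ • ∫ q in (0 : ℝ)..h, (F (h, q) - F (0, 0)) := by
    rw [intervalIntegral.integral_sub hi intervalIntegrable_const,
      intervalIntegral.integral_const, sub_zero, smul_sub, smul_smul, inv_mul_cancel₀ hh.ne',
      one_smul]
  have hb : ‖∫ q in (0 : ℝ)..h, (F (h, q) - F (0, 0))‖ ≤ ε / 2 * |h - 0| := by
    refine intervalIntegral.norm_integral_le_of_norm_le_const fun q hq => ?_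
    rw [uIoc_of_le hh.le] at hq
    rw [← dist_eq_norm]
    refine (hd (h, q) ?_).le
    rw [Prod.dist_eq, Real.dist_eq, Real.dist_eq, sub_zero, sub_zero, abs_of_pos hh,
      abs_of_pos hq.1]
    exact max_lt hd' (hq.2.trans_lt hd')
  rw [dist_eq_norm, e, norm_smul, norm_inv, Real.norm_eq_abs, abs_of_pos hh,
    inv_mul_lt_iff₀ hh]
  rw [sub_zero, abs_of_pos hh] at hb
  nlinarith

variable {X : Type*} [NormedAddCommGroup X] [InnerProductSpace ℂ X] [CompleteSpace X]

/-- The primitive of a convolution with the semigroup is the convolution with the primitive. -/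
theorem C0Semigroup.integral_conv (S : C0Semigroup X) {v : ℝ → X} {t : ℝ} (ht : 0 ≤ t)
    (hv : IntegrableOn v (Ioc 0 t)) :
    ∫ r in (0 : ℝ)..t, ∫ s in (0 : ℝ)..r, S.op (r - s) (v s) =
      ∫ s in (0 : ℝ)..t, S.op (t - s) (∫ q in (0 : ℝ)..s, v q) := by
  set μ : Measure ℝ := volume.restrict (Ioc 0 t) with hμ
  obtain ⟨M, hM0, hM⟩ := S.exists_bound t
  -- Used with `k = r - s` for the left side and `k = t - r` for the right side. Both sides then
  -- become the double integral of `S(q) v(s)` over `0 ≤ q ≤ t - s`.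
  have hint : ∀ k : ℝ × ℝ → ℝ, Continuous k → (∀ p ∈ Ioc 0 t ×ˢ Ioc 0 t, k p ≤ t) →
      Integrable (Function.uncurry fun r s => S.op (max (k (r, s)) 0) (v s)) (μ.prod μ) := by
    intro k hk hkt
    have hv2 : Integrable (fun p : ℝ × ℝ => v p.2) (μ.prod μ) := hv.comp_snd μ
    refine Integrable.mono' (hv2.norm.const_mul M)
      (S.continuous_joint.comp_aestronglyMeasurable (f := fun p : ℝ × ℝ => (k p, v p.2))
        (hk.aestronglyMeasurable.prodMk hv2.aestronglyMeasurable)) ?_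
    rw [hμ, Measure.prod_restrict]
    filter_upwards [ae_restrict_mem (measurableSet_Ioc.prod measurableSet_Ioc)] with p hp
    exact (S.op _).le_of_opNorm_le (hM _ ⟨le_max_right _ _, max_le (hkt p hp) ht⟩) _
  have h1 : ∫ r in (0 : ℝ)..t, ∫ s in (0 : ℝ)..r, S.op (r - s) (v s) =
      ∫ s in (0 : ℝ)..t, ∫ q in (0 : ℝ)..(t - s), S.op (max q 0) (v s) := by
    rw [← (intervalIntegral.integral_congr fun s _ => by
        simpa using intervalIntegral.integral_comp_sub_right
          (fun q => S.op (max q 0) (v s)) s (a := s) (b := t) :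
      ∫ s in (0 : ℝ)..t, ∫ r in s..t, S.op (max (r - s) 0) (v s) =
        ∫ s in (0 : ℝ)..t, ∫ q in (0 : ℝ)..(t - s), S.op (max q 0) (v s)),
      ← integral_triangle_swap ht (hint (fun p => p.1 - p.2) (by fun_prop)
        fun p hp => by linarith [hp.1.2, hp.2.1])]
    refine intervalIntegral.integral_congr fun r hr => ?_
    rw [uIcc_of_le ht] at hr
    refine intervalIntegral.integral_congr fun s hs => ?_
    rw [uIcc_of_le hr.1] at hs
    simp only [max_eq_left (sub_nonneg.2 hs.2)]
  have h2 : ∫ s in (0 : ℝ)..t, S.op (t - s) (∫ q in (0 : ℝ)..s, v q) =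
      ∫ s in (0 : ℝ)..t, ∫ q in (0 : ℝ)..(t - s), S.op (max q 0) (v s) := by
    rw [← (intervalIntegral.integral_congr fun s _ => by
        simpa using intervalIntegral.integral_comp_sub_left
          (fun q => S.op (max q 0) (v s)) t (a := s) (b := t) :
      ∫ s in (0 : ℝ)..t, ∫ r in s..t, S.op (max (t - r) 0) (v s) =
        ∫ s in (0 : ℝ)..t, ∫ q in (0 : ℝ)..(t - s), S.op (max q 0) (v s)),
      ← integral_triangle_swap ht (hint (fun p => t - p.1) (by fun_prop)
        fun p hp => by linarith [hp.1.1])]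
    refine intervalIntegral.integral_congr fun r hr => ?_
    rw [uIcc_of_le ht] at hr
    have hvr : IntervalIntegrable v volume 0 r := by
      rw [intervalIntegrable_iff_integrableOn_Ioc_of_le hr.1]
      exact hv.mono_set (Ioc_subset_Ioc_right hr.2)
    simp only [max_eq_left (sub_nonneg.2 hr.2)]
    exact ((S.op (t - r)).intervalIntegral_comp_comm hvr).symm
  rw [h1, h2]

end Convolution

/-! ## The delay semigroup preserves the graph of its generator -/

section DelayRegularity

variable {X : Type*} [NormedAddCommGroup X] [InnerProductSpace ℂ X] [CompleteSpace X]
  {S : C0Semigroup X} {κ τ : ℝ}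

/-- Splitting the Duhamel integral at `t` makes the part before `t` factor through `S(r)`. With
uniqueness of mild solutions this gives the semigroup law of `𝒮`. -/
theorem IsMildSolution.restart {y₀ : X} {φ y : ℝ → X} (hy : IsMildSolution S κ τ y₀ φ y)
    {t r : ℝ} (ht : 0 ≤ t) (hr : 0 ≤ r) (hi : IntegrableOn y (Ioc (-τ) (t + r - τ))) :
    y (t + r) = S.op r (y t) +
      (κ : ℂ) • ∫ s in (0 : ℝ)..r, S.op (r - s) (y (t + (s - τ))) := by
  have hsh : IntegrableOn (fun s => y (s - τ)) (Ioc 0 (t + r)) := by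
    simpa using (integrableOn_shift (τ := τ) hi).1
  have h1 := S.intervalIntegrable_conv _ (add_nonneg ht hr) hsh
  have h0 := S.intervalIntegrable_conv _ ht (hsh.mono_set (Ioc_subset_Ioc_right (by linarith)))
  have h1a := h1.mono_set (c := 0) (d := t) (uIcc_subset_uIcc_left
    (by rw [uIcc_of_le (by linarith)]; exact ⟨ht, by linarith⟩))
  have h1b := h1.mono_set (c := t) (d := t + r) (uIcc_subset_uIcc_right
    (by rw [uIcc_of_le (by linarith)]; exact ⟨ht, by linarith⟩))
  have e1 : ∫ s in (0 : ℝ)..t, S.op r (S.op (t - s) (y (s - τ))) =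
      ∫ s in (0 : ℝ)..t, S.op (t + r - s) (y (s - τ)) := by
    refine intervalIntegral.integral_congr fun s hs => ?_
    rw [uIcc_of_le ht] at hs
    rw [← S.op_add_apply hr (sub_nonneg.2 hs.2), show r + (t - s) = t + r - s by ring]
  have e2 : ∫ s in (0 : ℝ)..r, S.op (r - s) (y (t + (s - τ))) =
      ∫ s in t..(t + r), S.op (t + r - s) (y (s - τ)) := by
    have h := intervalIntegral.integral_comp_add_left
      (fun s => S.op (t + r - s) (y (s - τ))) t (a := 0) (b := r)
    rw [add_zero] at h
    rw [← h]
    refine intervalIntegral.integral_congr fun s _ => ?_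
    simp only [add_sub_add_left_eq_sub]
    rw [add_sub_assoc]
  rw [hy.duhamel _ (add_nonneg ht hr), hy.duhamel t ht, map_add, map_smul,
    ← (S.op r).intervalIntegral_comp_comm h0, e1, e2,
    ← intervalIntegral.integral_add_adjacent_intervals h1a h1b, smul_add, ← add_assoc,
    ← S.op_add_apply hr ht, add_comm r t]

theorem stateSolution_isMildSolution (hτ : 0 < τ) (Y : DelayState X τ) :
    IsMildSolution S κ τ Y.fst (Y.snd : ℝ → X) (stateSolution S κ τ Y) :=
  isMildSolution_delaySolution S κ hτ Y.fst (Y.snd : ℝ → X)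

theorem delaySemigroup_isMildSolution (hτ : 0 < τ) (Y : DelayState X τ) {t : ℝ} (ht : 0 ≤ t) :
    IsMildSolution S κ τ (delaySemigroup S κ hτ t Y).fst ((delaySemigroup S κ hτ t Y).snd : ℝ → X)
      (fun r => stateSolution S κ τ Y (t + r)) := by
  obtain ⟨h1, h2⟩ := delaySemigroup_spec S κ hτ ht Y _ (stateSolution_isMildSolution hτ Y)
  refine ⟨h2.mono fun θ h => h.symm, fun r hr => ?_⟩
  rw [h1]
  exact (stateSolution_isMildSolution hτ Y).restart ht hr (stateSolution_integrableOn S κ hτ Y _)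

theorem DelayState.ext_of_ae {Y Z : DelayState X τ} (h : Y.fst = Z.fst)
    (h' : ∀ᵐ θ ∂(histMeasure τ), (Y.snd : ℝ → X) θ = (Z.snd : ℝ → X) θ) : Y = Z :=
  (WithLp.ofLp_injective 2) (Prod.ext h (Lp.ext h'))

theorem delaySemigroup_add (hτ : 0 < τ) (Y : DelayState X τ) {s t : ℝ} (hs : 0 ≤ s) (ht : 0 ≤ t) :
    delaySemigroup S κ hτ (s + t) Y = delaySemigroup S κ hτ s (delaySemigroup S κ hτ t Y) := by
  obtain ⟨h1, h2⟩ := delaySemigroup_spec S κ hτ (add_nonneg hs ht) Y _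
    (stateSolution_isMildSolution hτ Y)
  obtain ⟨h3, h4⟩ := delaySemigroup_spec S κ hτ hs _ _ (delaySemigroup_isMildSolution hτ Y ht)
  refine DelayState.ext_of_ae ?_ ?_
  · rw [h1, h3, add_comm]
  · filter_upwards [h2, h4] with θ h5 h6
    rw [h5, h6]
    congr 1
    ring

theorem stateSolution_continuousOn (hτ : 0 < τ) (Y : DelayState X τ) :
    ContinuousOn (stateSolution S κ τ Y) (Ici 0) := by
  intro t ht
  obtain ⟨n, hn⟩ : ∃ n : ℕ, t / τ < n := exists_nat_gt _
  rw [div_lt_iff₀ hτ] at hn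
  obtain ⟨C, hC, h⟩ := stateSolution_memLp S κ hτ n
  obtain ⟨D, -, hD⟩ := stateSolution_sup_bound S κ hτ hC h
  refine ((hD Y).1 t ⟨ht, by linarith⟩).mono_of_mem_nhdsWithin ?_
  rw [← Ici_inter_Iic]
  exact inter_mem self_mem_nhdsWithin (mem_nhdsWithin_of_mem_nhds (Iic_mem_nhds (by linarith)))

theorem stateSolution_intervalIntegrable (hτ : 0 < τ) (Y : DelayState X τ) {a b : ℝ}
    (ha : -τ ≤ a) (hb : -τ ≤ b) : IntervalIntegrable (stateSolution S κ τ Y) volume a b := by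
  rw [intervalIntegrable_iff]
  exact (stateSolution_integrableOn S κ hτ Y (max a b)).mono_set
    (Ioc_subset_Ioc_left (le_min ha hb))

end DelayRegularity

/-! ### Invariance of the graph of `𝒜` and of the domain of `𝒜*`. -/

section DelayGraph

variable {X : Type*} [NormedAddCommGroup X] [InnerProductSpace ℂ X] [CompleteSpace X]
  {S : C0Semigroup X} {κ τ : ℝ}

theorem stateSolution_ae_eq_snd (hτ : 0 < τ) (Z : DelayState X τ) :
    ∀ᵐ s ∂(histMeasure τ), (Z.snd : ℝ → X) s = stateSolution S κ τ Z s :=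
  (stateSolution_isMildSolution hτ Z).history.mono fun _ h => h.symm

/-- For `(Y, Z)` in the graph of `𝒜` the solution with initial data `Z` is the derivative of the
solution with initial data `Y`. -/
theorem isMildSolution_of_mem_delayGraph (hτ : 0 < τ) {Y Z : DelayState X τ}
    (h : (Y, Z) ∈ delayGraph S.generator κ hτ) :
    IsMildSolution S κ τ Y.fst (Y.snd : ℝ → X)
      (fun t => Y.fst + ∫ s in (0 : ℝ)..t, stateSolution S κ τ Z s) := by
  obtain ⟨h1, h2, h3⟩ := h
  simp only at h1 h2 h3
  set z := stateSolution S κ τ Z with hz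
  have hzi : ∀ {a b : ℝ}, -τ ≤ a → -τ ≤ b → IntervalIntegrable z volume a b :=
    fun ha hb => stateSolution_intervalIntegrable hτ Z ha hb
  constructor
  · filter_upwards [h1, ae_restrict_mem measurableSet_Ioo] with t ht ht'
    rw [ht, History.integral_congr (stateSolution_ae_eq_snd hτ Z) ⟨ht'.1.le, ht'.2.le⟩]
  · intro t ht
    set w : ℝ → X := fun t => Y.fst + ∫ s in (0 : ℝ)..t, z s with hw
    set y₁ : X := S.generator ⟨Y.fst, h2⟩ with hy₁
    have hgraph : (Y.fst, y₁) ∈ S.generator.graph :=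
      (LinearPMap.mem_graph_iff _).2 ⟨⟨Y.fst, h2⟩, rfl, rfl⟩
    -- The boundary term in the definition of `𝒜`. Convolved with `S`, it will supply the constant
    -- part of `w (s - τ) = w (-τ) + ∫₀ˢ z (q - τ) dq`.
    have hZ : Z.fst = y₁ + (κ : ℂ) • w (-τ) := by
      rw [h3, History.integral_congr (stateSolution_ae_eq_snd (S := S) (κ := κ) hτ Z)
        ⟨le_rfl, by linarith⟩]
    have hsh : IntegrableOn (fun s => z (s - τ)) (Ioc 0 t) := by
      simpa using (integrableOn_shift (τ := τ) (stateSolution_integrableOn S κ hτ Z (t - τ))).1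
    have hwz : ∀ s, 0 ≤ s → w (s - τ) = w (-τ) + ∫ q in (0 : ℝ)..s, z (q - τ) := by
      intro s hs
      rw [intervalIntegral.integral_comp_sub_right (fun q => z q) τ, zero_sub, hw]
      simp only
      rw [add_assoc, intervalIntegral.integral_add_adjacent_intervals
        (hzi (by linarith) le_rfl) (hzi le_rfl (by linarith))]
    have hconv : ContinuousOn (fun r => ∫ s in (0 : ℝ)..r, S.op (r - s) (z (s - τ)))
        (Icc 0 t) := by
      simpa using S.continuousOn_mild 0 hsh
    -- The Duhamel formula for `z`, integrated over `[0, t]`.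
    have e1 : ∫ r in (0 : ℝ)..t, z r = (∫ r in (0 : ℝ)..t, S.op r Z.fst) +
        (κ : ℂ) • ∫ r in (0 : ℝ)..t, ∫ s in (0 : ℝ)..r, S.op (r - s) (z (s - τ)) := by
      rw [← intervalIntegral.integral_smul, ← intervalIntegral.integral_add
        (S.intervalIntegrable_op _ ht)
        (ContinuousOn.intervalIntegrable (by rw [uIcc_of_le ht]; exact hconv.const_smul _))]
      refine intervalIntegral.integral_congr fun r hr => ?_
      rw [uIcc_of_le ht] at hr
      exact (stateSolution_isMildSolution hτ Z).duhamel r hr.1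
    have e2 : ∫ r in (0 : ℝ)..t, S.op r Z.fst = S.op t Y.fst - Y.fst +
        (κ : ℂ) • ∫ s in (0 : ℝ)..t, S.op (t - s) (w (-τ)) := by
      have h4 := intervalIntegral.integral_comp_sub_left (fun r => S.op r (w (-τ))) t
        (a := 0) (b := t)
      rw [sub_self, sub_zero] at h4
      rw [h4, S.op_sub_self_eq_integral hgraph ht, ← intervalIntegral.integral_smul,
        ← intervalIntegral.integral_add (S.intervalIntegrable_op _ ht)
        (show IntervalIntegrable (fun s => (κ : ℂ) • S.op s (w (-τ))) volume 0 t from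
          (S.intervalIntegrable_op (w (-τ)) ht).smul (κ : ℂ))]
      simp only [hZ, map_add, map_smul]
    have hprim : IntegrableOn (fun s => ∫ q in (0 : ℝ)..s, z (q - τ)) (Ioc 0 t) := by
      have hi : IntervalIntegrable (fun s => z (s - τ)) volume 0 t :=
        (intervalIntegrable_iff_integrableOn_Ioc_of_le ht).2 hsh
      have := intervalIntegral.continuousOn_primitive_interval' hi (a := 0) left_mem_uIcc
      rw [uIcc_of_le ht] at this
      exact (this.integrableOn_Icc).mono_set Ioc_subset_Icc_self
    have e3 : ∫ s in (0 : ℝ)..t, S.op (t - s) (w (s - τ)) =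
        (∫ s in (0 : ℝ)..t, S.op (t - s) (w (-τ))) +
          ∫ s in (0 : ℝ)..t, S.op (t - s) (∫ q in (0 : ℝ)..s, z (q - τ)) := by
      rw [← intervalIntegral.integral_add
        (S.intervalIntegrable_conv (fun _ => w (-τ)) ht (integrable_const _))
        (S.intervalIntegrable_conv _ ht hprim)]
      refine intervalIntegral.integral_congr fun s hs => ?_
      rw [uIcc_of_le ht] at hs
      rw [hwz s hs.1, map_add]
    change Y.fst + ∫ s in (0 : ℝ)..t, z s =
      S.op t Y.fst + (κ : ℂ) • ∫ s in (0 : ℝ)..t, S.op (t - s) (w (s - τ))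
    rw [e1, e2, e3, S.integral_conv ht hsh, smul_add]
    abel

/-- The delay semigroup preserves the graph of `𝒜`. -/
theorem delaySemigroup_mem_delayGraph (hτ : 0 < τ) {Y Z : DelayState X τ}
    (h : (Y, Z) ∈ delayGraph S.generator κ hτ) {t : ℝ} (ht : 0 ≤ t) :
    (delaySemigroup S κ hτ t Y, delaySemigroup S κ hτ t Z) ∈ delayGraph S.generator κ hτ := by
  have hmild := isMildSolution_of_mem_delayGraph hτ h
  set z := stateSolution S κ τ Z with hz
  set w : ℝ → X := fun t => Y.fst + ∫ s in (0 : ℝ)..t, z s with hw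
  have hzi : ∀ {a b : ℝ}, -τ ≤ a → -τ ≤ b → IntervalIntegrable z volume a b :=
    fun ha hb => stateSolution_intervalIntegrable hτ Z ha hb
  have hzc : ContinuousOn z (Ici 0) := stateSolution_continuousOn hτ Z
  have hwsub : ∀ {a b : ℝ}, -τ ≤ a → -τ ≤ b → w b = w a + ∫ s in a..b, z s := by
    intro a b ha hb
    simp only [hw]
    rw [add_assoc, intervalIntegral.integral_add_adjacent_intervals (hzi (by linarith) ha)
      (hzi ha hb)]
  have hwc : ContinuousOn w (Ici (-τ)) := by
    intro s hs
    have h1 := intervalIntegral.continuousOn_primitive_interval' (a := -τ) (b₁ := -τ)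
      (b₂ := s + 1) (hzi le_rfl (by linarith [mem_Ici.1 hs])) left_mem_uIcc
    rw [uIcc_of_le (by linarith [mem_Ici.1 hs])] at h1
    have h2 : ContinuousOn w (Icc (-τ) (s + 1)) :=
      (continuousOn_const.add h1).congr fun r hr => hwsub le_rfl hr.1
    refine (h2 s ⟨hs, by linarith⟩).mono_of_mem_nhdsWithin ?_
    rw [← Ici_inter_Iic]
    exact inter_mem self_mem_nhdsWithin (mem_nhdsWithin_of_mem_nhds (Iic_mem_nhds (by linarith)))
  -- Restarting at `t` gives `S(h) w(t) - w(t) = (w(t+h) - w(t)) - κ ∫₀ʰ S(h-q) w(t+q-τ) dq`.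
  -- Divided by `h`, the right side converges because `w` has the continuous derivative `z` on `[0,
  -- ∞)` and is continuous on `[-τ, ∞)`. Clamping extends `z` and `w` continuously.
  have hA : (w t, z t - (κ : ℂ) • w (t - τ)) ∈ S.generator.graph := by
    rw [S.mem_generator_graph]
    have hz' : Continuous (fun q : ℝ => z (max (t + q) 0)) :=
      hzc.comp_continuous (by fun_prop) fun q => mem_Ici.2 (le_max_right _ _)
    have hw' : Continuous (fun q : ℝ => w (max (t + (q - τ)) (-τ))) :=
      hwc.comp_continuous (by fun_prop) fun q => mem_Ici.2 (le_max_right _ _)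
    have l1 := tendsto_average_of_continuous (F := fun p : ℝ × ℝ => z (max (t + p.2) 0))
      (hz'.comp continuous_snd)
    have l2 := tendsto_average_of_continuous
      (F := fun p : ℝ × ℝ => S.op (max (p.1 - p.2) 0) (w (max (t + (p.2 - τ)) (-τ))))
      (S.continuous_joint.comp (f := fun p : ℝ × ℝ => (p.1 - p.2, w (max (t + (p.2 - τ)) (-τ))))
        ((continuous_fst.sub continuous_snd).prodMk (hw'.comp continuous_snd)))
    have l3 := l1.sub (l2.const_smul (κ : ℂ))
    simp only [sub_self, max_self, S.op_zero, one_apply_eq_self, add_zero, max_eq_left ht,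
      zero_sub, ← sub_eq_add_neg, max_eq_left (show -τ ≤ t - τ by linarith)] at l3
    refine l3.congr' ?_
    filter_upwards [self_mem_nhdsWithin] with h hh
    have hh : 0 < h := hh
    have e1 : ∫ q in (0 : ℝ)..h, z (max (t + q) 0) = w (t + h) - w t := by
      rw [hwsub (a := t) (b := t + h) (by linarith) (by linarith), add_sub_cancel_left]
      have h4 := intervalIntegral.integral_comp_add_left z t (a := 0) (b := h)
      rw [add_zero] at h4
      rw [← h4]
      refine intervalIntegral.integral_congr fun q hq => ?_
      rw [uIcc_of_le hh.le] at hq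
      simp only [max_eq_left (add_nonneg ht hq.1)]
    have e2 : ∫ q in (0 : ℝ)..h, S.op (max (h - q) 0) (w (max (t + (q - τ)) (-τ))) =
        ∫ q in (0 : ℝ)..h, S.op (h - q) (w (t + (q - τ))) := by
      refine intervalIntegral.integral_congr fun q hq => ?_
      rw [uIcc_of_le hh.le] at hq
      simp only [max_eq_left (sub_nonneg.2 hq.2),
        max_eq_left (show -τ ≤ t + (q - τ) by linarith [hq.1])]
    have e3 := hmild.restart ht hh.le
      ((hwc.mono Icc_subset_Ici_self).integrableOn_Icc.mono_set Ioc_subset_Icc_self)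
    change w (t + h) = S.op h (w t) + (κ : ℂ) • ∫ s in (0 : ℝ)..h, S.op (h - s) (w (t + (s - τ)))
      at e3
    rw [e1, e2, smul_comm, ← smul_sub, Complex.coe_smul h⁻¹, e3,
      sub_right_comm, add_sub_cancel_right]
  obtain ⟨h1, h2⟩ := delaySemigroup_spec S κ hτ ht Y w hmild
  obtain ⟨h3, h4⟩ := delaySemigroup_spec S κ hτ ht Z z (stateSolution_isMildSolution hτ Z)
  have hint : ∀ θ ∈ Icc (-τ) 0,
      ∫ s in (0 : ℝ)..θ, ((delaySemigroup S κ hτ t Z).snd : ℝ → X) s = ∫ s in t..(t + θ), z s := by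
    intro θ hθ
    rw [History.integral_congr h4 hθ, intervalIntegral.integral_comp_add_left z t, add_zero]
  obtain ⟨x', hx1, hx2⟩ := (LinearPMap.mem_graph_iff _).1 hA
  refine ⟨?_, ?_⟩
  · filter_upwards [h2, ae_restrict_mem measurableSet_Ioo] with θ h5 h6
    rw [h5, h1, hint θ ⟨h6.1.le, h6.2.le⟩]
    exact hwsub (by linarith) (by linarith [h6.1])
  · have hx : (delaySemigroup S κ hτ t Y).fst = x' := h1.trans hx1.symm
    refine ⟨hx ▸ x'.2, ?_⟩
    have e : S.generator ⟨(delaySemigroup S κ hτ t Y).fst, hx ▸ x'.2⟩ = S.generator x' :=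
      congrArg _ (Subtype.ext hx)
    change (delaySemigroup S κ hτ t Z).fst = S.generator ⟨(delaySemigroup S κ hτ t Y).fst, _⟩ + _
    rw [e, hx2, h3, h1, hint (-τ) ⟨le_rfl, by linarith⟩,
      ← hwsub (a := t) (b := t + -τ) (by linarith) (by linarith), ← sub_eq_add_neg, sub_add_cancel]

/-- The adjoint delay semigroup preserves the domain of `𝒜*`. -/
theorem adjoint_delaySemigroup_mem_domain (hτ : 0 < τ) {z : ℂ}
    (hz : z ∈ opResolventSet (delayGenerator S.generator κ hτ)) {φ : DelayState X τ}
    (hφ : φ ∈ (delayGenerator S.generator κ hτ)†.domain) {t : ℝ} (ht : 0 ≤ t) :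
    ContinuousLinearMap.adjoint (delaySemigroup S κ hτ t) φ ∈
      (delayGenerator S.generator κ hτ)†.domain := by
  have hR := opResolvent_spec hz
  -- Invariance of the graph makes `𝒮(t)` commute with the resolvent of `𝒜`; that `𝒜` generates `𝒮`
  -- is not needed.
  refine hR.adjoint_mem_adjoint_domain (fun x => hR.comm_of_graph _ (fun Y Z h => ?_) x) hφ
  rw [delayGenerator_graph] at h ⊢
  exact delaySemigroup_mem_delayGraph hτ h ht

end DelayGraph

/-! ## The adjoint of the lifted control operator -/

section LiftedControl

variable {X : Type*} [NormedAddCommGroup X] [InnerProductSpace ℂ X] [CompleteSpace X]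
  {κ τ : ℝ}

/-- The embedding of `X` in `𝒳` as pairs `(x, θ ↦ x)`. -/
noncomputable def constState (X : Type*) [NormedAddCommGroup X] [InnerProductSpace ℂ X] (τ : ℝ) :
    X →L[ℂ] DelayState X τ :=
  (WithLp.prodContinuousLinearEquiv 2 ℂ X (History X τ)).symm.toContinuousLinearMap.comp
    ((ContinuousLinearMap.id ℂ X).prod (Lp.constL 2 (histMeasure τ) ℂ))

/-- Constant histories are convenient test states: the derivative vanishes and `f₂(-τ) = x`, so `𝒜`
returns a state with zero history. -/
theorem constState_mem_delayGraph {A : X →ₗ.[ℂ] X} (hτ : 0 < τ) {x y : X}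
    (h : (x, y) ∈ A.graph) :
    (constState X τ x, (WithLp.toLp 2 (y + (κ : ℂ) • x, 0) : DelayState X τ)) ∈
      delayGraph A κ hτ := by
  obtain ⟨x', rfl, rfl⟩ := (LinearPMap.mem_graph_iff A).1 h
  have h0 : ∀ θ ∈ Icc (-τ) 0, ∫ s in (0 : ℝ)..θ, ((0 : History X τ) : ℝ → X) s = 0 := by
    intro θ hθ
    rw [History.integral_congr (k := fun _ => 0) (Lp.coeFn_zero X 2 (histMeasure τ)) hθ,
      intervalIntegral.integral_zero]
  refine ⟨?_, x'.2, ?_⟩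
  · filter_upwards [Lp.coeFn_const (p := 2) (μ := histMeasure τ) (x' : X),
      ae_restrict_mem measurableSet_Ioo] with θ h1 h2
    change ((Lp.const 2 (histMeasure τ) (x' : X) : History X τ) : ℝ → X) θ =
      (x' : X) + ∫ s in (0 : ℝ)..θ, ((0 : History X τ) : ℝ → X) s
    rw [h0 θ ⟨h2.1.le, h2.2.le⟩, add_zero, h1]
    rfl
  · change A x' + (κ : ℂ) • (x' : X) = A x' + (κ : ℂ) • ((x' : X) +
      ∫ s in (0 : ℝ)..(-τ), ((0 : History X τ) : ℝ → X) s)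
    rw [h0 (-τ) ⟨le_rfl, by linarith⟩, add_zero]

theorem inner_toLp_zero (φ : DelayState X τ) (x : X) :
    inner ℂ φ (WithLp.toLp 2 (x, 0) : DelayState X τ) = inner ℂ φ.fst x := by
  rw [WithLp.prod_inner_apply]
  change inner ℂ φ.fst x + inner ℂ φ.snd (0 : History X τ) = _
  rw [inner_zero_right, add_zero]

/-- Testing `φ` against constant states bounds `⟨φ₁, A x + κ x⟩` by a multiple of `‖x‖`, and the
term with `κ` is itself bounded. -/
theorem fst_mem_adjoint_domain {A : X →ₗ.[ℂ] X} (hτ : 0 < τ) {φ : DelayState X τ}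
    (hφ : φ ∈ (delayGenerator A κ hτ)†.domain) : φ.fst ∈ A†.domain := by
  obtain ⟨w, hw⟩ := exists_inner_eq_of_mem_adjoint_domain hφ
  refine mem_adjoint_domain_of_inner
    (w := ContinuousLinearMap.adjoint (constState X τ) w - (κ : ℂ) • φ.fst) fun x y h => ?_
  have h1 := hw (constState X τ x) (WithLp.toLp 2 (y + (κ : ℂ) • x, 0)) (by
    rw [delayGenerator_graph]; exact constState_mem_delayGraph hτ h)
  rw [inner_toLp_zero, inner_add_right, inner_smul_right] at h1
  rw [inner_sub_left, ContinuousLinearMap.adjoint_inner_left, ← h1, inner_smul_left,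
    Complex.conj_ofReal, add_sub_cancel_right]

variable {U : Type*} [NormedAddCommGroup U] [InnerProductSpace ℂ U] [CompleteSpace U]

/-- The two pairings agree on `X`, where `⟨φ, (x, 0)⟩ = ⟨φ₁, x⟩`, and therefore on `X₋₁` by density.
-/
theorem controlAdjoint_liftedControl {A : X →ₗ.[ℂ] X} (hτ : 0 < τ) {ρ₀ ρ₁ : ℝ}
    (h₀ : (ρ₀ : ℂ) ∈ opResolventSet A) (h₁ : (ρ₁ : ℂ) ∈ opResolventSet (delayGenerator A κ hτ))
    (B : U →L[ℂ] Extrap A (ρ₀ : ℂ)) {φ : DelayState X τ}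
    (hφ : φ ∈ (delayGenerator A κ hτ)†.domain) :
    controlAdjoint h₁ (liftedControl A κ hτ h₀ h₁ B) φ = controlAdjoint h₀ B φ.fst := by
  have key : ∀ v : Extrap A (ρ₀ : ℂ), extrapPairing h₁ ⟨φ, hφ⟩ (extrapLift A κ hτ h₀ h₁ v) =
      extrapPairing h₀ ⟨φ.fst, fst_mem_adjoint_domain hτ hφ⟩ v := by
    intro v
    refine UniformSpace.Completion.induction_on v (isClosed_eq (by fun_prop) (by fun_prop))
      fun f => ?_
    have e : extrapLift A κ hτ h₀ h₁ (f : Extrap A (ρ₀ : ℂ)) =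
        Extrap.incl _ _ (preLift A κ hτ h₀ h₁ f) :=
      UniformSpace.Completion.map_coe (preLift A κ hτ h₀ h₁).uniformContinuous f
    rw [e, extrapPairing_incl]
    refine Eq.trans ?_ (extrapPairing_incl h₀ ⟨φ.fst, fst_mem_adjoint_domain hτ hφ⟩ f).symm
    exact inner_toLp_zero φ _
  refine ext_inner_right ℂ fun u => ?_
  rw [inner_controlAdjoint h₁ _ ⟨φ, hφ⟩ u,
    inner_controlAdjoint h₀ B ⟨φ.fst, fst_mem_adjoint_domain hτ hφ⟩ u]
  exact key (B u)

end LiftedControl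

/-! ## The adjoint delay semigroup for small times -/

section SmallTimes

variable {X : Type*} [NormedAddCommGroup X] [InnerProductSpace ℂ X] [CompleteSpace X]
  {S : C0Semigroup X} {κ τ : ℝ}

theorem stateSolution_ae_eq_zero (hτ : 0 < τ) (x : X) :
    ∀ᵐ s : ℝ, s ∈ Ioo (-τ) 0 → stateSolution S κ τ (WithLp.toLp 2 (x, 0)) s = 0 := by
  rw [← ae_restrict_iff' measurableSet_Ioo]
  filter_upwards [(stateSolution_isMildSolution (S := S) (κ := κ) hτ
    (WithLp.toLp 2 (x, 0))).history, Lp.coeFn_zero X 2 (histMeasure τ)] with s h1 h2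
  exact h1.trans h2

/-- Up to time `τ` the delayed term only sees the zero history. -/
theorem stateSolution_eq_op (hτ : 0 < τ) (x : X) {t : ℝ} (ht : t ∈ Icc 0 τ) :
    stateSolution S κ τ (WithLp.toLp 2 (x, 0)) t = S.op t x := by
  have hae := stateSolution_ae_eq_zero (S := S) (κ := κ) hτ x
  rw [(stateSolution_isMildSolution hτ _).duhamel t ht.1]
  have h0 : ∫ s in (0 : ℝ)..t,
      S.op (t - s) (stateSolution S κ τ (WithLp.toLp 2 (x, 0)) (s - τ)) = 0 := by
    refine intervalIntegral.integral_zero_ae ?_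
    -- The point `s = τ` is discarded, since there the delayed argument is `0`, where the solution
    -- equals `x`.
    filter_upwards [(measurePreserving_sub_right volume τ).quasiMeasurePreserving.ae hae,
      Measure.ae_ne volume τ] with s h1 h2 hs
    rw [uIoc_of_le ht.1] at hs
    rw [h1 ⟨by linarith [hs.1], sub_neg.2 (lt_of_le_of_ne (hs.2.trans ht.2) h2)⟩, map_zero]
  rw [h0, smul_zero, add_zero]
  rfl

theorem delaySemigroup_toLp_zero (hτ : 0 < τ) (x : X) {t : ℝ} (ht : t ∈ Icc 0 τ) :
    (delaySemigroup S κ hτ t (WithLp.toLp 2 (x, 0))).fst = S.op t x ∧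
      ∀ᵐ θ ∂(histMeasure τ), ((delaySemigroup S κ hτ t (WithLp.toLp 2 (x, 0))).snd : ℝ → X) θ =
        (Ioi (-t)).indicator (fun θ => S.op (t + θ) x) θ := by
  obtain ⟨h1, h2⟩ := delaySemigroup_spec S κ hτ ht.1 (WithLp.toLp 2 (x, 0)) _
    (stateSolution_isMildSolution hτ _)
  refine ⟨h1.trans (stateSolution_eq_op hτ x ht), ?_⟩
  have hae := stateSolution_ae_eq_zero (S := S) (κ := κ) hτ x
  filter_upwards [h2, ae_restrict_mem measurableSet_Ioo,
    ae_restrict_of_ae ((measurePreserving_add_left volume t).quasiMeasurePreserving.ae hae),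
    ae_restrict_of_ae (Measure.ae_ne volume (-t))] with θ h3 h4 h5 h6
  rw [h3]
  by_cases hθ : -t < θ
  · rw [indicator_of_mem (mem_Ioi.2 hθ)]
    exact stateSolution_eq_op hτ x ⟨by linarith, by linarith [h4.2, ht.2]⟩
  · rw [indicator_of_notMem (mt mem_Ioi.1 hθ)]
    have : θ < -t := lt_of_le_of_ne (not_lt.1 hθ) h6
    exact h5 ⟨by linarith [ht.1, h4.1], by linarith⟩

theorem History.comp_neg {a : ℝ} (haτ : a ≤ τ) (f : History X τ) :
    IntegrableOn (fun s => (f : ℝ → X) (-s)) (Ioc 0 a) ∧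
      ∫⁻ s in Ioc 0 a, ‖(f : ℝ → X) (-s)‖ₑ ^ 2 ≤ ‖f‖ₑ ^ 2 := by
  have hp := (Measure.measurePreserving_neg (volume : Measure ℝ)).restrict_preimage
    (measurableSet_Ico (a := -a) (b := 0))
  have e : Neg.neg ⁻¹' Ico (-a) 0 = Ioc 0 a := by
    ext s
    simp only [mem_preimage, mem_Ico, mem_Ioc, neg_le_neg_iff, neg_lt_zero]
    exact and_comm
  rw [e] at hp
  have hle : volume.restrict (Ico (-a) 0) ≤ histMeasure τ := by
    rw [Measure.restrict_congr_set (Ico_ae_eq_Ioc.trans Ioo_ae_eq_Ioc.symm)]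
    exact Measure.restrict_mono_set _ (Ioo_subset_Ioo_left (neg_le_neg haτ))
  have he : MeasurableEmbedding (fun s : ℝ => -s) := (MeasurableEquiv.neg ℝ).measurableEmbedding
  have hf := Lp.memLp f
  refine ⟨(hp.integrable_comp_emb he).2 ((hf.integrable (by norm_num)).mono_measure hle), ?_⟩
  rw [hp.lintegral_comp_emb he (fun s => ‖(f : ℝ → X) s‖ₑ ^ 2)]
  refine (lintegral_mono' hle le_rfl).trans_eq ?_
  have h2 := eLpNorm_nnreal_pow_eq_lintegral (f := (f : ℝ → X)) (p := 2) (μ := histMeasure τ)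
    (by norm_num)
  simp only [NNReal.coe_ofNat, ENNReal.rpow_ofNat, ENNReal.coe_ofNat] at h2
  rw [Lp.enorm_def, h2]

/-- For `t ≤ τ` the first component of the adjoint state solves an inhomogeneous equation with the
adjoint semigroup, driven by the history component of the initial state. -/
theorem fst_adjoint_delaySemigroup (hτ : 0 < τ) {z : ℂ} {R : X →L[ℂ] X}
    (hR : IsResolvent S.generator z R) (φ : DelayState X τ) {t : ℝ} (ht : t ∈ Icc 0 τ) :
    (ContinuousLinearMap.adjoint (delaySemigroup S κ hτ t) φ).fst =
      (S.dual hR).op t φ.fst +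
        ∫ s in (0 : ℝ)..t, (S.dual hR).op (t - s) ((φ.snd : ℝ → X) (-s)) := by
  refine ext_inner_right ℂ fun x => ?_
  obtain ⟨h1, h2⟩ := delaySemigroup_toLp_zero (S := S) (κ := κ) hτ x ht
  rw [← inner_toLp_zero, ContinuousLinearMap.adjoint_inner_left, WithLp.prod_inner_apply,
    inner_add_left, intervalIntegral_inner_left
      ((S.dual hR).intervalIntegrable_conv _ ht.1 (φ.snd.comp_neg ht.2).1)]
  simp only [S.dual_op, ContinuousLinearMap.adjoint_inner_left]
  refine congrArg₂ (· + ·) (congrArg _ h1) ?_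
  have e := intervalIntegral.integral_comp_neg (a := 0) (b := t)
    (fun θ => (inner ℂ ((φ.snd : ℝ → X) θ) (S.op (t + θ) x) : ℂ))
  simp only [neg_zero, ← sub_eq_add_neg] at e
  -- After `θ = -s`, both sides integrate `⟨φ₂(θ), S(t+θ) x⟩` over `(-t, 0)`: this is the part of
  -- the history interval on which the state of `(x, 0)` at time `t` is nonzero.
  rw [e, intervalIntegral.integral_of_le (by linarith [ht.1]), L2.inner_def]
  have e3 : Ioc (-τ) 0 ∩ Ioi (-t) = Ioc (-t) 0 := by
    rw [Ioc_inter_Ioi, max_eq_right (neg_le_neg ht.2)]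
  rw [← e3, ← setIntegral_indicator measurableSet_Ioi,
    ← Measure.restrict_congr_set (Ioo_ae_eq_Ioc (a := -τ) (b := 0))]
  refine integral_congr_ae ?_
  filter_upwards [h2] with θ h3
  refine (congrArg _ h3).trans ?_
  by_cases hθ : θ ∈ Ioi (-t)
  · rw [indicator_of_mem hθ, indicator_of_mem hθ]
    rfl
  · rw [indicator_of_notMem hθ, indicator_of_notMem hθ, inner_zero_right]

end SmallTimes

/-! ## Admissibility of the lifted control operator -/

section Admissibility

variable {X U : Type*} [NormedAddCommGroup X] [InnerProductSpace ℂ X] [CompleteSpace X]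
  [NormedAddCommGroup U] [InnerProductSpace ℂ U] [CompleteSpace U]

theorem ofReal_integral_sq_norm {f : ℝ → U} {μ : Measure ℝ} (hf : Integrable (fun t => ‖f t‖ ^ 2) μ) :
    ENNReal.ofReal (∫ t, ‖f t‖ ^ 2 ∂μ) = ∫⁻ t, ‖f t‖ₑ ^ 2 ∂μ := by
  rw [ofReal_integral_eq_lintegral_ofReal hf (Eventually.of_forall fun t => by positivity)]
  simp only [ENNReal.ofReal_pow (norm_nonneg _), ofReal_norm]

theorem integrable_sq_norm_of_lintegral_le {f : ℝ → U} {μ : Measure ℝ}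
    (hf : AEStronglyMeasurable f μ) {C : ℝ} (hC : 0 ≤ C)
    (h : ∫⁻ t, ‖f t‖ₑ ^ 2 ∂μ ≤ ENNReal.ofReal C) :
    Integrable (fun t => ‖f t‖ ^ 2) μ ∧ ∫ t, ‖f t‖ ^ 2 ∂μ ≤ C := by
  have hi : Integrable (fun t => ‖f t‖ ^ 2) μ := by
    refine ⟨hf.norm.pow 2, ?_⟩
    rw [hasFiniteIntegral_iff_enorm]
    simp only [enorm_pow, enorm_norm]
    exact h.trans_lt ENNReal.ofReal_lt_top
  refine ⟨hi, ?_⟩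
  rw [← ofReal_integral_sq_norm hi] at h
  exact (ENNReal.ofReal_le_ofReal_iff hC).1 h

/-- The hypothesis on `B*S*` in terms of the bounded operator `B*(z̄ I - A*)⁻¹`. -/
theorem lintegral_sq_le_of_admissible {S : C0Semigroup X} {z : ℂ}
    (hz : z ∈ opResolventSet S.generator) (B : U →L[ℂ] Extrap S.generator z) {T C : ℝ} (hT : 0 ≤ T)
    (hB : ∀ φ ∈ S.generator†.domain, ∫ t in (0 : ℝ)..T,
      ‖controlAdjoint hz B (ContinuousLinearMap.adjoint (S.op t) φ)‖ ^ 2 ≤ C * ‖φ‖ ^ 2) (η : X) :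
    ∫⁻ t in Ioc 0 T, ‖ContinuousLinearMap.adjoint ((extrapResolvent S.generator z).comp B)
      ((S.dual (opResolvent_spec hz)).op t η)‖ₑ ^ 2 ≤
      C.toNNReal * ‖ContinuousLinearMap.adjoint (opResolvent S.generator z) η‖ₑ ^ 2 := by
  set K := ContinuousLinearMap.adjoint ((extrapResolvent S.generator z).comp B) with hK
  have hR := opResolvent_spec hz
  have h := hB _ (hR.mem_adjoint_domain_iff.2 ⟨η, rfl⟩)
  have e : ∀ t ∈ uIcc 0 T, ‖controlAdjoint hz B (ContinuousLinearMap.adjoint (S.op t)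
      (ContinuousLinearMap.adjoint (opResolvent S.generator z) η))‖ ^ 2 =
      ‖K ((S.dual hR).op t η)‖ ^ 2 := by
    intro t ht
    rw [uIcc_of_le hT] at ht
    rw [← S.adjoint_resolvent_comm hR ht.1, controlAdjoint_adjoint_opResolvent hz B]
    rfl
  rw [intervalIntegral.integral_congr e, intervalIntegral.integral_of_le hT] at h
  -- The hypothesis bounds a Bochner integral, which would be `0` for a non-integrable function.
  -- Continuity of the adjoint orbit excludes this case.
  have hi : IntegrableOn (fun t => ‖K ((S.dual hR).op t η)‖ ^ 2) (Ioc 0 T) :=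
    ((((K.continuous.comp_continuousOn ((S.dual hR).strongCont η)).norm.pow 2).mono
      Icc_subset_Ici_self).integrableOn_Icc).mono_set Ioc_subset_Icc_self
  rw [← ofReal_integral_sq_norm hi]
  refine (ENNReal.ofReal_le_ofReal h).trans_eq ?_
  rw [ENNReal.ofReal_mul' (by positivity), ENNReal.ofReal_pow (norm_nonneg _), ofReal_norm]
  rfl

variable (κ : ℝ) {τ : ℝ} (hτ : 0 < τ) (S : C0Semigroup X) {ρ₀ ρ₁ : ℝ}
  (h₀ : (ρ₀ : ℂ) ∈ opResolventSet S.generator)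
  (h₁ : (ρ₁ : ℂ) ∈ opResolventSet (delayGenerator S.generator κ hτ))
  (B : U →L[ℂ] Extrap S.generator (ρ₀ : ℂ))

/-- The observation `t ↦ ℬ*𝒮*(t)φ`. -/
noncomputable def delayObservation (φ : DelayState X τ) (t : ℝ) : U :=
  controlAdjoint h₁ (liftedControl S.generator κ hτ h₀ h₁ B)
    (ContinuousLinearMap.adjoint (delaySemigroup S κ hτ t) φ)

/-- Square integrability on `(0, T)` of the observations of `φ ∈ D(𝒜*)`, with a bound in terms
of `‖φ‖`. -/
def DelayAdmissible (T : ℝ) : Prop :=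
  ∃ C : ℝ, 0 ≤ C ∧ ∀ φ ∈ (delayGenerator S.generator κ hτ)†.domain,
    IntervalIntegrable (fun t => ‖delayObservation κ hτ S h₀ h₁ B φ t‖ ^ 2) volume 0 T ∧
    ∫ t in (0 : ℝ)..T, ‖delayObservation κ hτ S h₀ h₁ B φ t‖ ^ 2 ≤ C * ‖φ‖ ^ 2

variable {κ hτ S h₀ h₁ B}

/-- The abstract observation estimate, applied to the adjoint semigroup with inhomogeneity `s ↦
φ₂(-s)`. -/
theorem exists_delayAdmissible {T C : ℝ} (hT : 0 < T)
    (hB : ∀ φ ∈ S.generator†.domain, ∫ t in (0 : ℝ)..T,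
      ‖controlAdjoint h₀ B (ContinuousLinearMap.adjoint (S.op t) φ)‖ ^ 2 ≤ C * ‖φ‖ ^ 2) :
    ∃ a : ℝ, 0 < a ∧ DelayAdmissible κ hτ S h₀ h₁ B a := by
  -- At most `τ` for the explicit formula of the adjoint state, at most `T` for the admissibility of
  -- `B`.
  set a : ℝ := min τ T with ha
  have ha0 : 0 < a := lt_min hτ hT
  have haτ : a ≤ τ := min_le_left _ _
  have hR := opResolvent_spec h₀
  obtain ⟨C', hC'⟩ := (S.dual hR).exists_lintegral_sq_observation_le
    (fun t ht x => S.adjoint_resolvent_comm hR ht x)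
    (fun t ht x => S.dual_op_sub_self_eq_integral hR ht x)
    (ContinuousLinearMap.adjoint ((extrapResolvent S.generator (ρ₀ : ℂ)).comp B)) (a := a)
    (C := C.toNNReal) (fun η => (lintegral_mono' (Measure.restrict_mono_set _
      (Ioc_subset_Ioc_right (min_le_right _ _))) le_rfl).trans
      (lintegral_sq_le_of_admissible h₀ B hT.le hB η))
  -- The factor `2` bounds each of the two components of `φ` by `‖φ‖`.
  refine ⟨a, ha0, C' * 2, by positivity, fun φ hφ => ?_⟩
  have hmem : ∀ t, 0 ≤ t → ContinuousLinearMap.adjoint (delaySemigroup S κ hτ t) φ ∈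
      (delayGenerator S.generator κ hτ)†.domain :=
    fun t ht => adjoint_delaySemigroup_mem_domain hτ h₁ hφ ht
  -- Preimages under `R*` are chosen separately for each `t`, with no claim of measurability in `t`.
  have hη : ∀ t, ∃ η, 0 ≤ t → ContinuousLinearMap.adjoint (opResolvent S.generator (ρ₀ : ℂ)) η =
      (ContinuousLinearMap.adjoint (delaySemigroup S κ hτ t) φ).fst := by
    intro t
    by_cases ht : 0 ≤ t
    · obtain ⟨η, hη⟩ := hR.mem_adjoint_domain_iff.1 (fst_mem_adjoint_domain hτ (hmem t ht))
      exact ⟨η, fun _ => hη⟩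
    · exact ⟨0, fun h => absurd h ht⟩
  choose η hη using hη
  have hobs : ∀ t ∈ Ioc 0 a, delayObservation κ hτ S h₀ h₁ B φ t =
      ContinuousLinearMap.adjoint ((extrapResolvent S.generator (ρ₀ : ℂ)).comp B) (η t) := by
    intro t ht
    rw [delayObservation, controlAdjoint_liftedControl hτ h₀ h₁ B (hmem t ht.1.le),
      ← hη t ht.1.le, controlAdjoint_adjoint_opResolvent]
  obtain ⟨hg1, hg2⟩ := φ.snd.comp_neg haτ
  obtain ⟨hm, hb⟩ := hC' φ.fst (fun s => (φ.snd : ℝ → X) (-s)) η hg1 fun t ht => by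
    rw [hη t ht.1.le, fst_adjoint_delaySemigroup hτ hR φ ⟨ht.1.le, ht.2.trans haτ⟩]
  have hobs' : ∀ᵐ t ∂volume.restrict (Ioc 0 a),
      ContinuousLinearMap.adjoint ((extrapResolvent S.generator (ρ₀ : ℂ)).comp B) (η t) =
        delayObservation κ hτ S h₀ h₁ B φ t := by
    filter_upwards [ae_restrict_mem measurableSet_Ioc] with t ht using (hobs t ht).symm
  have hle : ∫⁻ t in Ioc 0 a, ‖delayObservation κ hτ S h₀ h₁ B φ t‖ₑ ^ 2 ≤
      ENNReal.ofReal (C' * 2 * ‖φ‖ ^ 2) := by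
    rw [lintegral_congr_ae (hobs'.mono fun t ht => congrArg (fun u : U => ‖u‖ₑ ^ 2) ht.symm)]
    have h1 : ‖φ.fst‖ₑ ≤ ‖φ‖ₑ := by
      simpa only [← ofReal_norm] using ENNReal.ofReal_le_ofReal φ.norm_fst_le
    have h2 : ‖φ.snd‖ₑ ≤ ‖φ‖ₑ := by
      simpa only [← ofReal_norm] using ENNReal.ofReal_le_ofReal φ.norm_snd_le
    calc _ ≤ (C' : ENNReal) * (‖φ‖ₑ ^ 2 + ‖φ‖ₑ ^ 2) := hb.trans (mul_le_mul' le_rfl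
          (add_le_add (pow_le_pow_left' h1 2) (hg2.trans (pow_le_pow_left' h2 2))))
      _ = ENNReal.ofReal (C' * 2 * ‖φ‖ ^ 2) := by
          rw [mul_assoc, ENNReal.ofReal_mul (by positivity), ENNReal.ofReal_mul (by positivity),
            ENNReal.ofReal_pow (norm_nonneg _), ofReal_norm, ENNReal.ofReal_coe_nnreal,
            ENNReal.ofReal_ofNat, two_mul]
  obtain ⟨hi, hle'⟩ := integrable_sq_norm_of_lintegral_le (hm.congr hobs') (by positivity) hle
  exact ⟨(intervalIntegrable_iff_integrableOn_Ioc_of_le ha0.le).2 hi, by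
    rwa [intervalIntegral.integral_of_le ha0.le]⟩

theorem delayObservation_add {φ : DelayState X τ} {s t : ℝ} (hs : 0 ≤ s) (ht : 0 ≤ t) :
    delayObservation κ hτ S h₀ h₁ B φ (s + t) = delayObservation κ hτ S h₀ h₁ B
      (ContinuousLinearMap.adjoint (delaySemigroup S κ hτ t) φ) s := by
  rw [delayObservation, delayObservation]
  congr 1
  refine ext_inner_right ℂ fun Y => ?_
  simp only [ContinuousLinearMap.adjoint_inner_left]
  rw [add_comm, delaySemigroup_add hτ Y ht hs]

/-- On `[b, a + b]` the observation of `φ` is the observation on `[0, a]` of `𝒮*(b) φ`, which is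
again in `D(𝒜*)` and has norm at most `‖𝒮(b)‖ ‖φ‖`. -/
theorem DelayAdmissible.add {a b : ℝ} (ha : 0 ≤ a) (hb : 0 ≤ b)
    (hA : DelayAdmissible κ hτ S h₀ h₁ B a) (hB : DelayAdmissible κ hτ S h₀ h₁ B b) :
    DelayAdmissible κ hτ S h₀ h₁ B (a + b) := by
  obtain ⟨C, hC, h⟩ := hA
  obtain ⟨D, hD, k⟩ := hB
  refine ⟨D + C * ‖delaySemigroup S κ hτ b‖ ^ 2, by positivity, fun φ hφ => ?_⟩
  obtain ⟨k1, k2⟩ := k φ hφ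
  obtain ⟨i1, i2⟩ := h _ (adjoint_delaySemigroup_mem_domain hτ h₁ hφ hb)
  set ψ := ContinuousLinearMap.adjoint (delaySemigroup S κ hτ b) φ with hψ
  have e : EqOn (fun t => ‖delayObservation κ hτ S h₀ h₁ B ψ t‖ ^ 2)
      (fun t => ‖delayObservation κ hτ S h₀ h₁ B φ (t + b)‖ ^ 2) (uIcc 0 a) := by
    intro t ht
    rw [uIcc_of_le ha] at ht
    simp only [delayObservation_add ht.1 hb, hψ]
  have hn : ‖ψ‖ ^ 2 ≤ ‖delaySemigroup S κ hτ b‖ ^ 2 * ‖φ‖ ^ 2 := by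
    rw [← mul_pow]
    refine pow_le_pow_left₀ (norm_nonneg _) ?_ 2
    exact (ContinuousLinearMap.le_opNorm _ _).trans_eq (by rw [LinearIsometryEquiv.norm_map])
  have i1' : IntervalIntegrable (fun t => ‖delayObservation κ hτ S h₀ h₁ B φ t‖ ^ 2) volume
      b (a + b) := by
    have := (i1.congr (e.mono uIoc_subset_uIcc)).comp_sub_right b
    simpa using this
  rw [intervalIntegral.integral_congr e, intervalIntegral.integral_comp_add_right
    (fun t => ‖delayObservation κ hτ S h₀ h₁ B φ t‖ ^ 2) b, zero_add] at i2
  refine ⟨k1.trans i1', ?_⟩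
  rw [← intervalIntegral.integral_add_adjacent_intervals k1 i1']
  nlinarith [mul_le_mul_of_nonneg_left hn hC]

theorem DelayAdmissible.mono {a b : ℝ} (ha : 0 ≤ a) (hab : a ≤ b)
    (h : DelayAdmissible κ hτ S h₀ h₁ B b) : DelayAdmissible κ hτ S h₀ h₁ B a := by
  obtain ⟨C, hC, h⟩ := h
  refine ⟨C, hC, fun φ hφ => ?_⟩
  obtain ⟨k1, k2⟩ := h φ hφ
  refine ⟨k1.mono_set (by rw [uIcc_of_le ha, uIcc_of_le (ha.trans hab)]; exact Icc_subset_Icc_right hab),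
    le_trans ?_ k2⟩
  exact intervalIntegral.integral_mono_interval le_rfl ha hab
    (Eventually.of_forall fun t => by positivity) k1

theorem DelayAdmissible.nat_mul {a : ℝ} (ha : 0 ≤ a) (h : DelayAdmissible κ hτ S h₀ h₁ B a)
    (n : ℕ) : DelayAdmissible κ hτ S h₀ h₁ B (n * a) := by
  induction n with
  | zero => exact h.mono (by simp) (by simpa using ha)
  | succ n ih =>
    rw [Nat.cast_succ, add_mul, one_mul]
    exact ih.add (by positivity) ha h

end Admissibility

theorem lemma2p3 {X U : Type*}
    [NormedAddCommGroup X] [InnerProductSpace ℂ X] [CompleteSpace X]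
    [TopologicalSpace.SeparableSpace X]
    [NormedAddCommGroup U] [InnerProductSpace ℂ U] [CompleteSpace U]
    [TopologicalSpace.SeparableSpace U]
    (κ τ : ℝ) (hτ : 0 < τ)
    -- the semigroup `S` generated by `A = S.generator` is immediately compact
    (S : C0Semigroup X) (hS : S.ImmediatelyCompact)
    -- the control operator `B ∈ L(U; X₋₁)`
    (ρ₀ : ℝ) (hρ₀ : (ρ₀ : ℂ) ∈ opResolventSet S.generator)
    (B : U →L[ℂ] Extrap S.generator (ρ₀ : ℂ))
    -- `B` is admissible for `S`
    (hB : ∃ T : ℝ, 0 < T ∧ ∃ C : ℝ, 0 < C ∧ ∀ φ ∈ S.generator†.domain,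
      ∫ t in (0 : ℝ)..T,
        ‖controlAdjoint hρ₀ B (ContinuousLinearMap.adjoint (S.op t) φ)‖ ^ 2 ≤ C * ‖φ‖ ^ 2)
    -- the number `ρ₁` defining the norm of `𝒳₋₁`
    (ρ₁ : ℝ) (hρ₁ : (ρ₁ : ℂ) ∈ opResolventSet (delayGenerator S.generator κ hτ)) :
    ∀ T : ℝ, 0 < T → ∃ C : ℝ, 0 < C ∧
      ∀ φ ∈ (delayGenerator S.generator κ hτ)†.domain,
        (∀ t : ℝ, 0 ≤ t → ContinuousLinearMap.adjoint (delaySemigroup S κ hτ t) φ ∈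
          (delayGenerator S.generator κ hτ)†.domain) ∧
        IntervalIntegrable (fun t : ℝ =>
          ‖controlAdjoint hρ₁ (liftedControl S.generator κ hτ hρ₀ hρ₁ B)
            (ContinuousLinearMap.adjoint (delaySemigroup S κ hτ t) φ)‖ ^ 2) volume 0 T ∧
        ∫ t in (0 : ℝ)..T,
          ‖controlAdjoint hρ₁ (liftedControl S.generator κ hτ hρ₀ hρ₁ B)
            (ContinuousLinearMap.adjoint (delaySemigroup S κ hτ t) φ)‖ ^ 2 ≤ C * ‖φ‖ ^ 2 := by
  obtain ⟨T₀, hT₀, C, -, hB⟩ := hB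
  obtain ⟨a, ha, h⟩ := exists_delayAdmissible (κ := κ) (hτ := hτ) (h₁ := hρ₁) hT₀ hB
  intro T hT
  obtain ⟨n, hn⟩ := exists_nat_ge (T / a)
  rw [div_le_iff₀ ha] at hn
  obtain ⟨D, hD, hT'⟩ := (h.nat_mul ha.le n).mono hT.le hn
  -- `D` is only known to be nonnegative; adding `1` makes the constant strictly positive.
  refine ⟨D + 1, by positivity, fun φ hφ => ⟨fun t ht =>
    adjoint_delaySemigroup_mem_domain hτ hρ₁ hφ ht, (hT' φ hφ).1, (hT' φ hφ).2.trans ?_⟩⟩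
  gcongr
  linarith
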